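/- Let $K\in\mathbb{R}^{3\times 3}$ be symmetric with entries bounded in absolute value by a constant $\kappa_0$. Let $d,m\ge 1$ and $r$ be integers, let $\alpha\ge 0$, and let $A^\star,B^\star,C^\star\in\mathbb{R}^{d\times r}$ be matrices all of whose rows have Euclidean norm at most $\sqrt{\alpha}$. Put $U^\star=[A^\star;B^\star;C^\star]\in\mathbb{R}^{3d\times r}$ (stacked vertically) and $X^\star=U^\star {U^\star}^\top$. For $t=(i,j,k)\in[d]^3$ let $A_t\in\mathbb{R}^{3d\times 3d}$ be the matrix that equals $K$ on the rows and columns $i,\ d+j,\ 2d+k$ and is $0$ elsewhere (so that $\langle A_t,X^\star\rangle$ is the $t$-th entry of the quadratic tensor defined by $A^\star,B^\star,C^\star$ and $K$), where $\langle M,N\rangle=\operatorname{tr}(MN^\top)$. For a nonempty finite set, or finite list counted with multiplicity, $S$ of elements of $[d]^3$, let $$L_S(X)=\frac{1}{|S|}\sum_{t\in S}\langle A_t,X-X^\star\rangle^2 ,$$ and let $\mathcal G$ be the set of positive semidefinite $X\in\mathbb{R}^{3d\times 3d}$ with $\operatorname{tr}(X)\le 6d\alpha$ and $X_{i,i}\le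 2\alpha$ for all $i\in[3d]$. Then, for a constant $c$ that depends only on $\kappa_0$, $$\mathbb{E}_{\Omega}\Big[\sup_{X\in\mathcal G}\big|L_\Omega(X)-L_{[d]^3}(X)\big|\Big]\le c\,\alpha^2\sqrt{\frac dm+\frac{d^2\log d}{m^2}} ,$$ where every supremum is finite, both when $\Omega$ is a uniformly random subset of $[d]^3$ with $m$ elements ($m\le d^3$) and when $\Omega$ is a list of $m$ independent uniformly random elements of $[d]^3$. -/

import Mathlib

open scoped BigOperators

namespace QuadTensor

/-- A triple of indices in `[d]³`; the three coordinates are `t 0`, `t 1`, `t 2`. -/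
abbrev Triple (d : ℕ) : Type := Fin 3 → Fin d

/-- The `3d` row indices of a vertically stacked matrix: block number and index in the block. -/
abbrev Idx (d : ℕ) : Type := Fin 3 × Fin d

/-- The stacked matrix `[A; B; C]` of size `3d × r`. -/
def stack {d r : ℕ} (A B C : Matrix (Fin d) (Fin r) ℝ) : Matrix (Idx d) (Fin r) ℝ :=
  Matrix.of fun p l => (![A, B, C] p.1) p.2 l

/-- The true matrix `X⋆ = U⋆ U⋆ᵀ` with `U⋆ = [A; B; C]`. -/
def trueMatrix {d r : ℕ} (A B C : Matrix (Fin d) (Fin r) ℝ) : Matrix (Idx d) (Idx d) ℝ :=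
  stack A B C * (stack A B C).transpose

/-- The matrix inner product `⟨M, N⟩ = tr (M Nᵀ)`. -/
def frobInner {ι : Type*} [Fintype ι] (M N : Matrix ι ι ℝ) : ℝ :=
  (M * N.transpose).trace

/-- The sensing matrix of a triple `t`: it equals the kernel matrix `K` on the rows and columns
`(0, t 0)`, `(1, t 1)`, `(2, t 2)`, and it is zero elsewhere. -/
def sensing {d : ℕ} (K : Matrix (Fin 3) (Fin 3) ℝ) (t : Triple d) : Matrix (Idx d) (Idx d) ℝ :=
  Matrix.of fun p q => if p.2 = t p.1 ∧ q.2 = t q.1 then K p.1 q.1 else 0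

/-- The squared error `⟨A_t, X - X⋆⟩²` at the triple `t`. -/
def sqError {d : ℕ} (K : Matrix (Fin 3) (Fin 3) ℝ) (Xstar X : Matrix (Idx d) (Idx d) ℝ)
    (t : Triple d) : ℝ :=
  (frobInner (sensing K t) (X - Xstar)) ^ 2

/-- The loss `L_S(X)` over a set `S` of triples. -/
noncomputable def loss {d : ℕ} (K : Matrix (Fin 3) (Fin 3) ℝ)
    (Xstar : Matrix (Idx d) (Idx d) ℝ) (S : Finset (Triple d))
    (X : Matrix (Idx d) (Idx d) ℝ) : ℝ :=
  (1 / (S.card : ℝ)) * ∑ t ∈ S, sqError K Xstar X t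

/-- The loss over a list `t_1, …, t_m` of sampled triples, counted with multiplicity. -/
noncomputable def sampleLoss {d m : ℕ} (K : Matrix (Fin 3) (Fin 3) ℝ)
    (Xstar : Matrix (Idx d) (Idx d) ℝ) (t : Fin m → Triple d)
    (X : Matrix (Idx d) (Idx d) ℝ) : ℝ :=
  (1 / (m : ℝ)) * ∑ l, sqError K Xstar X (t l)

/-- The set `𝒢` of positive semidefinite `3d × 3d` matrices with trace at most `6dα` and all
diagonal entries at most `2α`. -/
def G (d : ℕ) (α : ℝ) : Set (Matrix (Idx d) (Idx d) ℝ) :=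
  {X | X.PosSemidef ∧ X.trace ≤ 6 * d * α ∧ ∀ i, X i i ≤ 2 * α}

/-- The values over `X ∈ 𝒢` of the deviation `|ℓ(X) - L_{[d]³}(X)|` of an empirical loss `ℓ`
from the loss over all triples. -/
def deviations {d : ℕ} (K : Matrix (Fin 3) (Fin 3) ℝ) (Xstar : Matrix (Idx d) (Idx d) ℝ)
    (α : ℝ) (ℓ : Matrix (Idx d) (Idx d) ℝ → ℝ) : Set ℝ :=
  (fun X => |ℓ X - loss K Xstar Finset.univ X|) '' G d α

end QuadTensor

/-!
The proof has three layers. All probability spaces are finite, so expectations are uniform averages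
`𝔼`, and a bound for the mean of a supremum over `𝒢` is phrased as a bound that holds along every
*choice* of a point of `𝒢` for each outcome; suprema are only formed at the very end
(`expect_sSup_deviations_le`).

*Reduction to a random matrix.* Sampling without replacement is dominated by sampling with
replacement (`expect_powersetCard_le`, Hoeffding), which is symmetrized (`symmetrization`). The
square is Lipschitz on the bounded range of the forms `⟨A_t, X - X⋆⟩`, so the `contraction`
principle leaves the Rademacher averages of these linear forms. They split into the nine blocks of
`K`. In a diagonal block the operator norm of the random matrix would cost a logarithmic factor;
there the bound `X i i ≤ 2α` and the `ℓ¹` norm of the signed counts suffice. In an off-diagonal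
block trace duality over `𝒢` calls for the norm of the signed adjacency matrix of a random
bipartite multigraph.

*The norm of a signed multigraph.* If every multiplicity is at most `M` and every degree at most
`p * M`, then the `2p`-th trace moment of the signed adjacency matrix is at most
`|V| (C p M) ^ p` (`expect_trace_pow_le`), without a logarithmic loss. This follows the comparison
idea of Bandeira and van Handel: a closed walk contributes to the moment according to its shape
only, and step by step the walks can be simulated by walks in the complete multigraph on `3p` vertices
with all multiplicities equal to `M`, since at each step that multigraph offers at least as many
fresh edges and fresh vertices (`walkWeight_le`). For the complete multigraph the dimension is
comparable to `p`, so a net of the unit ball is affordable (`expect_signedAdj_pow_le_of_card`).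

*Degrees and multiplicities.* For `m` uniform triples the maximal degree has mean
`O(log d + m / d)`, and the maximal multiplicity has mean `O(1 + m / (d log d))`
(`expect_max_count_le`). With `p` of order `degree / M + log d` the norm has mean
`O(√(log d + m / d))`, which is the claimed rate after multiplication by `d α² / m`.
-/

open scoped BigOperators

namespace QuadTensor

open Finset

/-! ### Rademacher averages -/

/-- The sign `±1` coded by a Boolean. -/
def sgn (b : Bool) : ℝ := cond b 1 (-1)

@[simp] lemma sgn_true : sgn true = 1 := rfl
@[simp] lemma sgn_false : sgn false = -1 := rfl
@[simp] lemma sgn_not (b : Bool) : sgn (!b) = -sgn b := by cases b <;> simp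

lemma expect_bool (f : Bool → ℝ) : 𝔼 b, f b = (f true + f false) / 2 := by
  rw [Fintype.expect_eq_sum_div_card]; simp

/-- Independence of the coordinates of a uniformly random function. -/
lemma expect_pi_prod {L T : Type*} [Fintype L] [DecidableEq L] [Fintype T] (g : L → T → ℝ) :
    𝔼 t : L → T, ∏ l, g l (t l) = ∏ l, 𝔼 s, g l s := by
  simp only [Fintype.expect_eq_sum_div_card, Finset.prod_div_distrib, Finset.prod_univ_sum,
    Fintype.piFinset_univ, Finset.prod_const, Finset.card_univ, Fintype.card_fun, Nat.cast_pow]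

/-- A monomial in independent signs has mean `1` if it is a perfect square, and `0` otherwise. -/
lemma expect_list_sgn {L : Type*} [Fintype L] [DecidableEq L] (ls : List L) :
    𝔼 ε : L → Bool, (ls.map fun l => sgn (ε l)).prod =
      if ∀ l, Even (ls.count l) then 1 else 0 := by
  have h1 : ∀ ε : L → Bool, (ls.map fun l => sgn (ε l)).prod
      = ∏ l, (fun l b => sgn b ^ ls.count l) l (ε l) := by
    intro ε
    rw [Finset.prod_list_map_count]
    refine Finset.prod_subset (Finset.subset_univ _) fun l _ hl => ?_
    rw [List.count_eq_zero_of_not_mem (by simpa using hl), pow_zero]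
  simp_rw [h1]
  rw [expect_pi_prod (fun l b => sgn b ^ ls.count l)]
  split_ifs with h
  · exact Finset.prod_eq_one fun l _ => by rw [expect_bool]; simp [(h l).neg_one_pow]
  · push Not at h
    obtain ⟨l, hl⟩ := h
    refine Finset.prod_eq_zero (Finset.mem_univ l) ?_
    rw [expect_bool]; simp [(Nat.not_even_iff_odd.1 hl).neg_one_pow]

/-- The mean of a monomial in independent signs is unchanged under injective relabelling. -/
lemma expect_list_sgn_map {L L' : Type*} [Fintype L] [DecidableEq L] [Fintype L'] [DecidableEq L']
    (ls : List L) (ψ : L → L') (hψ : Set.InjOn ψ {l | l ∈ ls}) :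
    𝔼 ε : L' → Bool, ((ls.map ψ).map fun l => sgn (ε l)).prod =
      𝔼 ε : L → Bool, (ls.map fun l => sgn (ε l)).prod := by
  have hc : ∀ l ∈ ls, (ls.map ψ).count (ψ l) = ls.count l := by
    intro l hl
    rw [List.count, List.countP_map, List.count]
    refine List.countP_congr fun a ha => ?_
    simp only [Function.comp, beq_iff_eq]
    exact ⟨fun h => hψ ha hl h, fun h => by rw [h]⟩
  rw [expect_list_sgn, expect_list_sgn]
  refine if_congr ⟨fun h l => ?_, fun h l' => ?_⟩ rfl rfl
  · by_cases hl : l ∈ ls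
    · rw [← hc l hl]; exact h _
    · rw [List.count_eq_zero_of_not_mem hl]; exact Even.zero
  · by_cases hl : l' ∈ ls.map ψ
    · obtain ⟨l, hl', rfl⟩ := List.mem_map.1 hl
      rw [hc l hl']; exact h _
    · rw [List.count_eq_zero_of_not_mem hl]; exact Even.zero

lemma sum_le_sum_of_card_le {A B : Type*} (s : Finset A) (t : Finset B) (f : A → ℝ) (g : B → ℝ)
    (hfg : ∀ a ∈ s, ∀ b ∈ t, f a ≤ g b) (hg : ∀ b ∈ t, 0 ≤ g b) (hc : s.card ≤ t.card) :
    ∑ a ∈ s, f a ≤ ∑ b ∈ t, g b := by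
  rcases t.eq_empty_or_nonempty with rfl | ht
  · have : s = ∅ := by simpa using hc
    simp [this]
  obtain ⟨b, hb, hmin⟩ := t.exists_min_image g ht
  calc ∑ a ∈ s, f a ≤ ∑ _a ∈ s, g b := Finset.sum_le_sum fun a ha => hfg a ha b hb
    _ = s.card * g b := by simp
    _ ≤ t.card * g b := by gcongr; exact hg b hb
    _ = ∑ _b ∈ t, g b := by simp
    _ ≤ ∑ b ∈ t, g b := Finset.sum_le_sum hmin

/-! ### Comparison of walks in signed multigraphs -/

section partialIso

/-- A partial isomorphism from the multigraph `e` to the multigraph `e'`: `φ` is injective on the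
vertices `U`, `ψ` is injective on the listed edges, and `ψ` carries the ends of an edge to their
images under `φ`. -/
structure IsPartialIso {V L V' L' : Type*} (e : L → Sym2 V) (e' : L' → Sym2 V') (U : Finset V)
    (ls : List L) (φ : V → V') (ψ : L → L') : Prop where
  injOn_vertices : Set.InjOn φ U
  injOn_edges : Set.InjOn ψ {l | l ∈ ls}
  ends_mem : ∀ l ∈ ls, ∀ v ∈ e l, v ∈ U
  map_ends : ∀ l ∈ ls, e' (ψ l) = (e l).map φ

variable {V L V' L' : Type*} {e : L → Sym2 V} {e' : L' → Sym2 V'} {U : Finset V} {ls : List L}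
  {φ : V → V'} {ψ : L → L'}

lemma IsPartialIso.cons_of_mem (h : IsPartialIso e e' U ls φ ψ) {l : L} (hl : l ∈ ls) :
    IsPartialIso e e' U (l :: ls) φ ψ := by
  have hmem : ∀ a, a ∈ l :: ls ↔ a ∈ ls := fun a => by
    simp only [List.mem_cons, or_iff_right_iff_imp]; rintro rfl; exact hl
  obtain ⟨h1, h2, h3, h4⟩ := h
  constructor <;> simpa only [hmem]

lemma map_update_of_notMem [DecidableEq L] {l : L} (hl : l ∉ ls) (l' : L') :
    ls.map (Function.update ψ l l') = ls.map ψ :=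
  List.map_congr_left fun _ ha =>
    Function.update_of_ne (ne_of_mem_of_not_mem ha hl) _ _

lemma IsPartialIso.cons_of_notMem [DecidableEq L] (h : IsPartialIso e e' U ls φ ψ)
    {l : L} {l' : L'} {x y : V}
    (hx : x ∈ U) (hy : y ∈ U) (hl : l ∉ ls) (hl' : l' ∉ ls.map ψ) (he : e l = s(x, y))
    (he' : e' l' = s(φ x, φ y)) :
    IsPartialIso e e' U (l :: ls) φ (Function.update ψ l l') := by
  have hup : ∀ a ∈ ls, Function.update ψ l l' a = ψ a := fun a ha =>
    Function.update_of_ne (ne_of_mem_of_not_mem ha hl) _ _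
  have hne : ∀ a ∈ ls, ψ a ≠ l' := fun a ha h => hl' (h ▸ List.mem_map_of_mem ha)
  refine ⟨h.injOn_vertices, ?_, ?_, ?_⟩
  · intro a ha b hb hab
    simp only [Set.mem_ofPred_eq, List.mem_cons] at ha hb
    rcases ha with rfl | ha <;> rcases hb with rfl | hb
    · rfl
    · rw [Function.update_self, hup b hb] at hab; exact absurd hab.symm (hne b hb)
    · rw [Function.update_self, hup a ha] at hab; exact absurd hab (hne a ha)
    · rw [hup a ha, hup b hb] at hab; exact h.injOn_edges ha hb hab
  · intro a ha v hv
    rcases List.mem_cons.1 ha with rfl | ha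
    · rw [he, Sym2.mem_iff] at hv
      rcases hv with rfl | rfl <;> assumption
    · exact h.ends_mem a ha v hv
  · intro a ha
    rcases List.mem_cons.1 ha with rfl | ha
    · rw [Function.update_self, he', he, Sym2.map_mk]
    · rw [hup a ha, h.map_ends a ha]

lemma IsPartialIso.insert_vertex [DecidableEq V] [DecidableEq V']
    (h : IsPartialIso e e' U ls φ ψ) {y : V} {y' : V'}
    (hy : y ∉ U) (hy' : y' ∉ U.image φ) :
    IsPartialIso e e' (insert y U) ls (Function.update φ y y') ψ := by
  have hup : ∀ a ∈ U, Function.update φ y y' a = φ a := fun a ha =>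
    Function.update_of_ne (ne_of_mem_of_not_mem ha hy) _ _
  have hne : ∀ a ∈ U, φ a ≠ y' := fun a ha h => hy' (h ▸ Finset.mem_image_of_mem _ ha)
  refine ⟨?_, h.injOn_edges, fun l hl v hv => Finset.mem_insert_of_mem (h.ends_mem l hl v hv), ?_⟩
  · intro a ha b hb hab
    simp only [Finset.coe_insert, Set.mem_insert_iff, Finset.mem_coe] at ha hb
    rcases ha with rfl | ha <;> rcases hb with rfl | hb
    · rfl
    · rw [Function.update_self, hup b hb] at hab; exact absurd hab.symm (hne b hb)
    · rw [Function.update_self, hup a ha] at hab; exact absurd hab (hne a ha)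
    · rw [hup a ha, hup b hb] at hab; exact h.injOn_vertices ha hb hab
  · intro l hl
    rw [h.map_ends l hl]
    exact Sym2.map_congr fun v hv => (hup v (h.ends_mem l hl v hv)).symm

/-- Along a partial isomorphism the used edges between two visited vertices correspond. -/
lemma IsPartialIso.filter_eq_image [DecidableEq V] [DecidableEq V'] [Fintype L]
    [DecidableEq L] [Fintype L'] [DecidableEq L'] (h : IsPartialIso e e' U ls φ ψ) {x y : V}
    (hx : x ∈ U) (hy : y ∈ U) :
    {l' ∈ ({l' | e' l' = s(φ x, φ y)} : Finset L') | l' ∈ ls.map ψ} =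
      {l ∈ ({l | e l = s(x, y)} : Finset L) | l ∈ ls}.image ψ := by
  ext l'
  simp only [Finset.mem_filter, Finset.mem_univ, true_and, List.mem_map, Finset.mem_image]
  constructor
  · rintro ⟨h1, l, hl, rfl⟩
    refine ⟨l, ⟨?_, hl⟩, rfl⟩
    rw [h.map_ends l hl] at h1
    have hends := h.ends_mem l hl
    revert h1 hends
    induction e l using Sym2.ind with
    | _ a b =>
      intro h1 hends
      have ha : a ∈ U := hends a (by simp)
      have hb : b ∈ U := hends b (by simp)
      rw [Sym2.map_mk, Sym2.eq_iff] at h1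
      rw [Sym2.eq_iff]
      rcases h1 with ⟨h1, h2⟩ | ⟨h1, h2⟩
      · exact Or.inl ⟨h.injOn_vertices ha hx h1, h.injOn_vertices hb hy h2⟩
      · exact Or.inr ⟨h.injOn_vertices ha hy h1, h.injOn_vertices hb hx h2⟩
  · rintro ⟨l, ⟨h1, hl⟩, rfl⟩
    exact ⟨by rw [h.map_ends l hl, h1, Sym2.map_mk], l, hl, rfl⟩

end partialIso

section walks
variable {V L V' L' : Type*} [Fintype V] [DecidableEq V] [Fintype L] [DecidableEq L]
  [Fintype V'] [DecidableEq V'] [Fintype L'] [DecidableEq L']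

/-- The signed adjacency matrix of a multigraph with edges `L` on the vertices `V`: `e` assigns to
an edge its two ends, and the signs of parallel edges are added. -/
def signedAdj (e : L → Sym2 V) (ε : L → Bool) : Matrix V V ℝ :=
  Matrix.of fun x y => ∑ l with e l = s(x, y), sgn (ε l)

/-- The averaged weight of the walks of length `n` from `x` to `z`, with the history `ls` of
edges used before. -/
noncomputable def walkWeight (e : L → Sym2 V) (n : ℕ) (ls : List L) (x z : V) : ℝ :=
  𝔼 ε : L → Bool, (ls.map fun l => sgn (ε l)).prod * (signedAdj e ε ^ n) x z

lemma walkWeight_zero (e : L → Sym2 V) (ls : List L) (x z : V) :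
    walkWeight e 0 ls x z =
      if x = z then 𝔼 ε : L → Bool, (ls.map fun l => sgn (ε l)).prod else 0 := by
  split_ifs with h <;> simp [walkWeight, h]

/-- The first step of a walk moves its edge into the history. -/
lemma walkWeight_succ (e : L → Sym2 V) (n : ℕ) (ls : List L) (x z : V) :
    walkWeight e (n + 1) ls x z =
      ∑ y, ∑ l with e l = s(x, y), walkWeight e n (l :: ls) y z := by
  simp only [walkWeight]
  simp_rw [← Finset.expect_sum_comm]
  refine Finset.expect_congr rfl fun ε _ => ?_
  rw [pow_succ', Matrix.mul_apply, Finset.mul_sum]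
  refine Finset.sum_congr rfl fun y _ => ?_
  simp only [signedAdj, Matrix.of_apply, Finset.sum_mul, Finset.mul_sum, List.map_cons,
    List.prod_cons]
  exact Finset.sum_congr rfl fun l _ => by ring

lemma walkWeight_nonneg (e : L → Sym2 V) (n : ℕ) (ls : List L) (x z : V) :
    0 ≤ walkWeight e n ls x z := by
  induction n generalizing ls x with
  | zero =>
    rw [walkWeight_zero, expect_list_sgn]
    split_ifs <;> norm_num
  | succ n ih =>
    rw [walkWeight_succ]
    exact Finset.sum_nonneg fun _ _ => Finset.sum_nonneg fun _ _ => ih _ _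

/-- Comparison of walk weights: the walks in a multigraph `e` are simulated by walks in a
multigraph `e'` with larger multiplicities in which, even after `k` vertices are removed, all
degrees are larger. -/
theorem walkWeight_le (e : L → Sym2 V) (e' : L' → Sym2 V') (k : ℕ)
    (hmult : ∀ z z', ({l | e l = z} : Finset L).card ≤ ({l' | e' l' = z'} : Finset L').card)
    (hdeg : ∀ x x' (W : Finset V'), W.card ≤ k →
      ∑ y, ({l | e l = s(x, y)} : Finset L).card ≤
        ∑ y' ∈ Wᶜ, ({l' | e' l' = s(x', y')} : Finset L').card)
    (n : ℕ) (U : Finset V) (ls : List L) (φ : V → V') (ψ : L → L') (x z : V)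
    (h : IsPartialIso e e' U ls φ ψ) (hx : x ∈ U) (hz : z ∈ U) (hn : U.card + n ≤ k + 1) :
    walkWeight e n ls x z ≤ walkWeight e' n (ls.map ψ) (φ x) (φ z) := by
  induction n generalizing U ls φ ψ x with
  | zero =>
    by_cases hxz : x = z
    · subst hxz
      rw [walkWeight_zero, walkWeight_zero, if_pos rfl, if_pos rfl,
        expect_list_sgn_map ls ψ h.injOn_edges]
    · rw [walkWeight_zero, if_neg hxz]
      exact walkWeight_nonneg _ _ _ _ _
  | succ n ih =>
    rw [walkWeight_succ, walkWeight_succ, ← Finset.sum_add_sum_compl U,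
      ← Finset.sum_add_sum_compl (U.image φ)]
    refine add_le_add ?_ ?_
    -- steps to a visited vertex, along a used or along a new edge
    · rw [Finset.sum_image h.injOn_vertices]
      refine Finset.sum_le_sum fun y hy => ?_
      rw [← Finset.sum_filter_add_sum_filter_not _ (fun l => l ∈ ls),
        ← Finset.sum_filter_add_sum_filter_not ({l' | e' l' = s(φ x, φ y)} : Finset L')
          (fun l' => l' ∈ ls.map ψ), h.filter_eq_image hx hy]
      have hinj : Set.InjOn ψ ({l ∈ ({l | e l = s(x, y)} : Finset L) | l ∈ ls} : Finset L) :=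
        h.injOn_edges.mono fun l hl => (Finset.mem_filter.1 hl).2
      refine add_le_add ?_ (sum_le_sum_of_card_le _ _ _ _ ?_ ?_ ?_)
      · rw [Finset.sum_image hinj]
        exact Finset.sum_le_sum fun l hl =>
          ih U (l :: ls) φ ψ y (h.cons_of_mem (Finset.mem_filter.1 hl).2) hy hz (by omega)
      · intro l hl l' hl'
        simp only [Finset.mem_filter, Finset.mem_univ, true_and] at hl hl'
        have := ih U (l :: ls) φ (Function.update ψ l l') y
          (h.cons_of_notMem hx hy hl.2 hl'.2 hl.1 hl'.1) hy hz (by omega)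
        rwa [List.map_cons, Function.update_self, map_update_of_notMem hl.2] at this
      · exact fun _ _ => walkWeight_nonneg _ _ _ _ _
      · have h1 := Finset.card_filter_add_card_filter_not (s := ({l | e l = s(x, y)} : Finset L))
          (fun l => l ∈ ls)
        have h2 := Finset.card_filter_add_card_filter_not
          (s := ({l' | e' l' = s(φ x, φ y)} : Finset L')) (fun l' => l' ∈ ls.map ψ)
        rw [h.filter_eq_image hx hy, Finset.card_image_of_injOn hinj] at h2
        have h3 := hmult s(x, y) s(φ x, φ y)
        omega
    -- steps to a new vertex
    · rw [Finset.sum_sigma', Finset.sum_sigma']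
      refine sum_le_sum_of_card_le _ _ _ _ ?_ (fun _ _ => walkWeight_nonneg _ _ _ _ _) ?_
      · rintro ⟨y, l⟩ hl ⟨y', l'⟩ hl'
        simp only [Finset.mem_sigma, Finset.mem_compl, Finset.mem_filter, Finset.mem_univ,
          true_and] at hl hl'
        obtain ⟨hy, hl⟩ := hl
        obtain ⟨hy', hl'⟩ := hl'
        have hxy : x ≠ y := fun h => hy (h ▸ hx)
        have hzy : z ≠ y := fun h => hy (h ▸ hz)
        have hlm : l ∉ ls := fun hm => hy (h.ends_mem l hm y (by simp [hl]))
        have hlm' : l' ∉ ls.map ψ := by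
          intro hm
          obtain ⟨a, ha, rfl⟩ := List.mem_map.1 hm
          have hmem : y' ∈ e' (ψ a) := by simp [hl']
          rw [h.map_ends a ha, Sym2.mem_map] at hmem
          obtain ⟨v, hv, rfl⟩ := hmem
          exact hy' (Finset.mem_image_of_mem _ (h.ends_mem a ha v hv))
        have hiso := (h.insert_vertex hy hy').cons_of_notMem
          (Finset.mem_insert_of_mem hx) (Finset.mem_insert_self y U) hlm hlm' hl
          (by rw [Function.update_self, Function.update_of_ne hxy, hl'])
        have := ih _ _ _ _ y hiso (Finset.mem_insert_self y U) (Finset.mem_insert_of_mem hz)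
          (by have := Finset.card_insert_le y U; omega)
        rwa [List.map_cons, Function.update_self, Function.update_self,
          map_update_of_notMem hlm, Function.update_of_ne hzy] at this
      · rw [Finset.card_sigma, Finset.card_sigma]
        refine le_trans (Finset.sum_le_sum_of_subset (Finset.subset_univ _)) ?_
        exact hdeg x (φ x) _ (Finset.card_image_le.trans (by omega))

end walks

/-! ### Nets and moments of small signed matrices -/

section net
variable {E : Type*} [NormedAddCommGroup E] [InnerProductSpace ℝ E]

variable (E) in
/-- The unit ball of a space of dimension `n` has a `1/2`-net of at most `5 ^ n` points. -/
lemma exists_half_net [FiniteDimensional ℝ E] :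
    ∃ T : Finset E, T.card ≤ 5 ^ Module.finrank ℝ E ∧ (∀ a ∈ T, ‖a‖ ≤ 1) ∧
    ∀ x : E, ‖x‖ ≤ 1 → ∃ a ∈ T, ‖x - a‖ ≤ 1 / 2 := by
  classical
  let P : Finset E → Prop := fun s =>
    (∀ c ∈ s, ‖c‖ ≤ 2) ∧ ∀ c ∈ s, ∀ d ∈ s, c ≠ d → 1 ≤ ‖c - d‖
  have hP : ∀ s, P s → s.card ≤ 5 ^ Module.finrank ℝ E := fun s hs =>
    Besicovitch.card_le_of_separated s hs.1 hs.2
  let Q : ℕ → Prop := fun n => ∃ s, P s ∧ s.card = n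
  have hQ0 : Q 0 := ⟨∅, by simp [P], rfl⟩
  obtain ⟨s, hs, hcard⟩ : Q (Nat.findGreatest Q (5 ^ Module.finrank ℝ E)) :=
    Nat.findGreatest_spec (Nat.zero_le _) hQ0
  have hmax : ∀ t, P t → t.card ≤ s.card := fun t ht =>
    hcard ▸ Nat.le_findGreatest (hP t ht) ⟨t, ht, rfl⟩
  refine ⟨s.image (fun a => (1 / 2 : ℝ) • a), Finset.card_image_le.trans (hP s hs), ?_, ?_⟩
  · intro a ha
    obtain ⟨c, hc, rfl⟩ := Finset.mem_image.1 ha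
    rw [norm_smul]
    have := hs.1 c hc
    norm_num
    linarith
  · intro x hx
    by_contra! hcon
    have hfar : ∀ c ∈ s, 1 < ‖(2 : ℝ) • x - c‖ := by
      intro c hc
      have h1 := hcon _ (Finset.mem_image_of_mem _ hc)
      have h2 : (2 : ℝ) • x - c = (2 : ℝ) • (x - (1 / 2 : ℝ) • c) := by
        rw [smul_sub, smul_smul]; norm_num
      rw [h2, norm_smul]
      norm_num at h1 ⊢
      linarith
    have hnot : (2 : ℝ) • x ∉ s := fun h => by
      have := hfar _ h
      norm_num at this
    have hnew : P (insert ((2 : ℝ) • x) s) := by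
      refine ⟨?_, ?_⟩
      · intro c hc
        rcases Finset.mem_insert.1 hc with rfl | hc
        · rw [norm_smul]; norm_num; exact hx
        · exact hs.1 c hc
      · intro c hc d hd hcd
        rcases Finset.mem_insert.1 hc with rfl | hc <;> rcases Finset.mem_insert.1 hd with rfl | hd
        · exact absurd rfl hcd
        · exact (hfar d hd).le
        · rw [norm_sub_rev]; exact (hfar c hc).le
        · exact hs.2 c hc d hd hcd
    have := hmax _ hnew
    rw [Finset.card_insert_of_notMem hnot] at this
    omega

/-- The operator norm is attained up to a factor `4` on a `1/2`-net. -/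
lemma exists_norm_le_of_half_net {T : Finset E}
    (hT : ∀ x : E, ‖x‖ ≤ 1 → ∃ a ∈ T, ‖x - a‖ ≤ 1 / 2) (A : E →L[ℝ] E) :
    ∃ a ∈ T, ∃ b ∈ T, ‖A‖ ≤ 4 * |inner ℝ a (A b)| := by
  have hne : T.Nonempty := by
    obtain ⟨a, ha, -⟩ := hT 0 (by simp)
    exact ⟨a, ha⟩
  obtain ⟨b, hb, hbmax⟩ := T.exists_max_image (fun b => ‖A b‖) hne
  obtain ⟨a, ha, hamax⟩ := T.exists_max_image (fun a => |inner ℝ a (A b)|) hne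
  refine ⟨a, ha, b, hb, ?_⟩
  have h1 : ‖A‖ ≤ 2 * ‖A b‖ := by
    have : ‖A‖ ≤ ‖A‖ / 2 + ‖A b‖ := by
      refine A.opNorm_le_of_unit_norm (by positivity) fun x hx => ?_
      obtain ⟨c, hc, hxc⟩ := hT x hx.le
      have h2 : A x = A (x - c) + A c := by simp
      rw [h2]
      refine (norm_add_le _ _).trans (add_le_add ?_ (hbmax c hc))
      refine (A.le_opNorm _).trans ?_
      nlinarith [norm_nonneg A]
    linarith
  have h2 : ‖A b‖ ≤ 2 * |inner ℝ a (A b)| := by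
    rcases eq_or_ne (A b) 0 with h0 | h0
    · simp [h0]
    have hpos : 0 < ‖A b‖ := norm_pos_iff.2 h0
    let u := (‖A b‖)⁻¹ • A b
    have hu : ‖u‖ = 1 := norm_smul_inv_norm (𝕜 := ℝ) h0
    obtain ⟨c, hc, huc⟩ := hT u hu.le
    have h3 : inner ℝ u (A b) = ‖A b‖ := by
      simp only [u, real_inner_smul_left, real_inner_self_eq_norm_sq]
      field_simp
    have h4 : ‖A b‖ = inner ℝ (u - c) (A b) + inner ℝ c (A b) := by
      rw [← inner_add_left, sub_add_cancel, h3]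
    have h5 := (real_inner_le_norm (u - c) (A b)).trans
      (mul_le_mul_of_nonneg_right huc hpos.le)
    have h6 := (le_abs_self (inner ℝ c (A b))).trans (hamax c hc)
    linarith
  linarith

end net

section moments

/-- Even moments of Rademacher sums, from the subgaussian bound on their Laplace transform. -/
lemma expect_sgn_sum_pow_le {L : Type*} [Fintype L] [DecidableEq L] (c : L → ℝ) {M p : ℕ}
    (hp : 1 ≤ p) (hM : 1 ≤ M) (hc : ∑ l, c l ^ 2 ≤ 2 * M) :
    𝔼 ε : L → Bool, (∑ l, sgn (ε l) * c l) ^ (2 * p) ≤ (24 * p * M : ℝ) ^ p := by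
  have hp' : (1 : ℝ) ≤ p := by exact_mod_cast hp
  have hM' : (1 : ℝ) ≤ M := by exact_mod_cast hM
  have hlap : ∀ θ : ℝ, 𝔼 ε : L → Bool, Real.exp (θ * ∑ l, sgn (ε l) * c l) ≤
      Real.exp (θ ^ 2 * M) := by
    intro θ
    have h1 : ∀ ε : L → Bool, Real.exp (θ * ∑ l, sgn (ε l) * c l)
        = ∏ l, (fun l b => Real.exp (θ * (sgn b * c l))) l (ε l) := by
      intro ε
      rw [Finset.mul_sum, Real.exp_sum]
    simp_rw [h1]
    rw [expect_pi_prod (fun l b => Real.exp (θ * (sgn b * c l)))]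
    calc ∏ l, 𝔼 b, Real.exp (θ * (sgn b * c l)) ≤ ∏ l, Real.exp (θ ^ 2 * c l ^ 2 / 2) := by
          refine Finset.prod_le_prod
            (fun l _ => Finset.expect_nonneg fun _ _ => (Real.exp_pos _).le)
            fun l _ => ?_
          rw [expect_bool]
          have := Real.cosh_le_exp_half_sq (θ * c l)
          rw [Real.cosh_eq] at this
          simpa [mul_pow] using this
      _ = Real.exp (θ ^ 2 * ((∑ l, c l ^ 2) / 2)) := by
          rw [← Real.exp_sum]; congr 1
          rw [Finset.sum_div, Finset.mul_sum]
          exact Finset.sum_congr rfl fun l _ => by ring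
      _ ≤ Real.exp (θ ^ 2 * M) := by
          gcongr; linarith
  -- this `θ` optimizes `exp (θ ^ 2 * M) / θ ^ (2 * p)`
  set θ : ℝ := √(p / M) with hθ
  have hθ2 : θ ^ 2 = p / M := Real.sq_sqrt (by positivity)
  have hpt : ∀ S : ℝ, S ^ (2 * p) ≤
      ((2 * p).factorial : ℝ) * (M / p) ^ p * (Real.exp (θ * S) + Real.exp (-θ * S)) := by
    intro S
    have h1 := Real.pow_div_factorial_le_exp _ (abs_nonneg (θ * S)) (2 * p)
    have h2 : Real.exp |θ * S| ≤ Real.exp (θ * S) + Real.exp (-θ * S) := by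
      rcases abs_cases (θ * S) with ⟨h, -⟩ | ⟨h, -⟩ <;> rw [h]
      · linarith [Real.exp_pos (-θ * S)]
      · rw [← neg_mul]; linarith [Real.exp_pos (θ * S)]
    have h3 : |θ * S| ^ (2 * p) = (p / M) ^ p * S ^ (2 * p) := by
      rw [pow_mul, sq_abs, mul_pow, hθ2, mul_pow, ← pow_mul]
    rw [h3, div_le_iff₀ (by positivity)] at h1
    have h4 : S ^ (2 * p) = (M / p : ℝ) ^ p * ((p / M) ^ p * S ^ (2 * p)) := by
      rw [← mul_assoc, ← mul_pow]
      have : (M / p : ℝ) * (p / M) = 1 := by field_simp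
      rw [this]; simp
    rw [h4]
    calc (M / p : ℝ) ^ p * ((p / M) ^ p * S ^ (2 * p))
        ≤ (M / p : ℝ) ^ p * ((Real.exp (θ * S) + Real.exp (-θ * S)) * (2 * p).factorial) := by
          exact mul_le_mul_of_nonneg_left (h1.trans (by gcongr)) (by positivity)
      _ = _ := by ring
  have hexp : Real.exp p ≤ 3 ^ p := by
    rw [← Real.exp_one_pow]
    gcongr
    exact Real.exp_one_lt_three.le
  calc 𝔼 ε : L → Bool, (∑ l, sgn (ε l) * c l) ^ (2 * p)
      ≤ 𝔼 ε : L → Bool, ((2 * p).factorial : ℝ) * (M / p) ^ p *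
          (Real.exp (θ * ∑ l, sgn (ε l) * c l) + Real.exp (-θ * ∑ l, sgn (ε l) * c l)) :=
        Finset.expect_le_expect fun ε _ => hpt _
    _ = ((2 * p).factorial : ℝ) * (M / p) ^ p *
          (𝔼 ε : L → Bool, Real.exp (θ * ∑ l, sgn (ε l) * c l) +
            𝔼 ε : L → Bool, Real.exp (-θ * ∑ l, sgn (ε l) * c l)) := by
        rw [← Finset.mul_expect, Finset.expect_add_distrib]
    _ ≤ ((2 * p).factorial : ℝ) * (M / p) ^ p *
          (Real.exp (θ ^ 2 * M) + Real.exp ((-θ) ^ 2 * M)) := by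
        gcongr <;> exact hlap _
    _ = ((2 * p).factorial : ℝ) * (M / p) ^ p * (2 * Real.exp p) := by
        rw [neg_sq, hθ2, div_mul_cancel₀ _ (by positivity)]; ring
    _ ≤ ((2 * p : ℝ) ^ (2 * p)) * (M / p) ^ p * (2 ^ p * 3 ^ p) := by
        gcongr
        · exact_mod_cast Nat.factorial_le_pow (2 * p)
        · exact le_self_pow₀ (by norm_num) (by omega)
    _ = (24 * p * M : ℝ) ^ p := by
        rw [pow_mul, ← mul_pow, ← mul_pow, ← mul_pow]
        congr 1
        field_simp
        ring

end moments

section model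
variable {V L : Type*} [Fintype V] [DecidableEq V] [Fintype L] [DecidableEq L]

lemma card_filter_sym2_le (z : Sym2 V) :
    ({q : V × V | s(q.1, q.2) = z} : Finset (V × V)).card ≤ 2 := by
  induction z using Sym2.ind with
  | _ a b =>
    refine (Finset.card_le_card (t := {(a, b), (b, a)}) ?_).trans Finset.card_le_two
    rintro ⟨x, y⟩ h
    simpa [Sym2.eq_iff] using h

/-- A bilinear form in the signed adjacency matrix is a Rademacher sum over the edges. -/
lemma inner_signedAdj {L : Type*} [Fintype L] (e : L → Sym2 V) (ε : L → Bool)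
    (a b : EuclideanSpace ℝ V) :
    inner ℝ a (Matrix.toEuclideanCLM (𝕜 := ℝ) (signedAdj e ε) b) =
      ∑ l, sgn (ε l) * ∑ q : V × V with s(q.1, q.2) = e l, a q.1 * b q.2 := by
  have h1 : ∀ l, sgn (ε l) * ∑ q : V × V with s(q.1, q.2) = e l, a q.1 * b q.2 =
      ∑ x, ∑ y, if e l = s(x, y) then a x * (sgn (ε l) * b y) else 0 := by
    intro l
    rw [Finset.mul_sum, Finset.sum_filter, Fintype.sum_prod_type]
    refine Finset.sum_congr rfl fun x _ => Finset.sum_congr rfl fun y _ => ?_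
    simp only [eq_comm (a := s(x, y)), mul_left_comm]
  simp_rw [h1]
  rw [Matrix.inner_toEuclideanCLM, Finset.sum_comm]
  simp only [dotProduct, Matrix.mulVec, signedAdj, Matrix.of_apply, Finset.sum_filter]
  refine Finset.sum_congr rfl fun x _ => ?_
  rw [Finset.sum_comm, Finset.mul_sum]
  refine Finset.sum_congr rfl fun y _ => ?_
  rw [Finset.sum_mul, Finset.mul_sum]
  refine Finset.sum_congr rfl fun l _ => ?_
  split_ifs <;> simp

lemma sum_sq_coeff_le {L : Type*} [Fintype L] (e : L → Sym2 V) {M : ℕ}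
    (hM : ∀ z, ({l | e l = z} : Finset L).card ≤ M) (a b : EuclideanSpace ℝ V) (ha : ‖a‖ ≤ 1)
    (hb : ‖b‖ ≤ 1) :
    ∑ l, (∑ q : V × V with s(q.1, q.2) = e l, a q.1 * b q.2) ^ 2 ≤ 2 * M := by
  have h1 : ∀ l, (∑ q : V × V with s(q.1, q.2) = e l, a q.1 * b q.2) ^ 2 ≤
      2 * ∑ q : V × V with s(q.1, q.2) = e l, (a q.1 ^ 2 * b q.2 ^ 2) := by
    intro l
    refine sq_sum_le_card_mul_sum_sq.trans ?_
    simp_rw [mul_pow]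
    gcongr
    exact_mod_cast card_filter_sym2_le (e l)
  have ha' : ∑ x, a x ^ 2 ≤ 1 := by
    rw [← EuclideanSpace.real_norm_sq_eq]; exact pow_le_one₀ (norm_nonneg _) ha
  have hb' : ∑ x, b x ^ 2 ≤ 1 := by
    rw [← EuclideanSpace.real_norm_sq_eq]; exact pow_le_one₀ (norm_nonneg _) hb
  calc _ ≤ ∑ l, 2 * ∑ q : V × V with s(q.1, q.2) = e l, (a q.1 ^ 2 * b q.2 ^ 2) :=
        Finset.sum_le_sum fun l _ => h1 l
    _ = 2 * ∑ q : V × V, ({l | e l = s(q.1, q.2)} : Finset L).card * (a q.1 ^ 2 * b q.2 ^ 2) := by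
        rw [← Finset.mul_sum]
        congr 1
        simp_rw [Finset.sum_filter]
        rw [Finset.sum_comm]
        refine Finset.sum_congr rfl fun q _ => ?_
        rw [← Finset.sum_filter, Finset.sum_const, nsmul_eq_mul]
        simp only [eq_comm (a := s(q.1, q.2))]
    _ ≤ 2 * ∑ q : V × V, M * (a q.1 ^ 2 * b q.2 ^ 2) := by
        gcongr with q _
        exact hM _
    _ = 2 * (M * ((∑ x, a x ^ 2) * ∑ y, b y ^ 2)) := by
        rw [← Finset.mul_sum, Fintype.sum_prod_type, Finset.sum_mul_sum]
    _ ≤ 2 * (M * (1 * 1)) := by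
        gcongr
    _ = 2 * M := by ring

lemma entry_pow_le (X : Matrix V V ℝ) {n : ℕ} (hn : 0 < n) (x : V) :
    (X ^ n) x x ≤ ‖Matrix.toEuclideanCLM (n := V) (𝕜 := ℝ) X‖ ^ n := by
  let u : EuclideanSpace ℝ V := EuclideanSpace.single x 1
  have hu : ‖u‖ = 1 := by simp [u]
  have h1 : (X ^ n) x x =
      inner ℝ u ((Matrix.toEuclideanCLM (n := V) (𝕜 := ℝ) X ^ n) u) := by
    rw [← map_pow, Matrix.inner_toEuclideanCLM]
    simp [u]
  rw [h1]
  refine (real_inner_le_norm _ _).trans ?_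
  rw [hu, one_mul]
  refine ((Matrix.toEuclideanCLM (n := V) (𝕜 := ℝ) X ^ n).le_opNorm u).trans ?_
  rw [hu, mul_one]
  exact norm_pow_le' _ hn

/-- Moment bound for a diagonal entry of the powers of a signed adjacency matrix, by a net of the
unit ball. The net has `5 ^ (3 * p)` points, which costs only a
constant factor in the base of the `p`-th power; `6000000 = 4 ^ 2 * 5 ^ 6 * 24`. -/
lemma expect_signedAdj_pow_le_of_card (e : L → Sym2 V) {M p : ℕ} (hp : 1 ≤ p) (hM1 : 1 ≤ M)
    (hV : Fintype.card V = 3 * p) (hM : ∀ z, ({l | e l = z} : Finset L).card ≤ M) (x : V) :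
    𝔼 ε : L → Bool, (signedAdj e ε ^ (2 * p)) x x ≤ (6000000 * (p * M) : ℝ) ^ p := by
  obtain ⟨T, hTc, hT1, hT⟩ := exists_half_net (EuclideanSpace ℝ V)
  rw [finrank_euclideanSpace, hV] at hTc
  let F : EuclideanSpace ℝ V → EuclideanSpace ℝ V → (L → Bool) → ℝ := fun a b ε =>
    ∑ l, sgn (ε l) * ∑ q : V × V with s(q.1, q.2) = e l, a q.1 * b q.2
  have hnn : ∀ a b ε, 0 ≤ (4 : ℝ) ^ (2 * p) * F a b ε ^ (2 * p) := fun a b ε =>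
    mul_nonneg (by positivity) ((even_two_mul p).pow_nonneg _)
  have hpt : ∀ ε : L → Bool, (signedAdj e ε ^ (2 * p)) x x ≤
      ∑ a ∈ T, ∑ b ∈ T, 4 ^ (2 * p) * F a b ε ^ (2 * p) := by
    intro ε
    have hnorm := exists_norm_le_of_half_net hT
      (Matrix.toEuclideanCLM (n := V) (𝕜 := ℝ) (signedAdj e ε))
    simp only [inner_signedAdj] at hnorm
    obtain ⟨a, ha, b, hb, hab⟩ := hnorm
    refine (entry_pow_le (signedAdj e ε) (by omega) x).trans ?_
    refine (pow_le_pow_left₀ (norm_nonneg _) hab _).trans ?_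
    rw [mul_pow, (even_two_mul p).pow_abs]
    exact (Finset.single_le_sum (f := fun b => (4 : ℝ) ^ (2 * p) * F a b ε ^ (2 * p))
      (fun b _ => hnn a b ε) hb).trans
      (Finset.single_le_sum (f := fun a => ∑ b ∈ T, (4 : ℝ) ^ (2 * p) * F a b ε ^ (2 * p))
        (fun a _ => Finset.sum_nonneg fun b _ => hnn a b ε) ha)
  calc 𝔼 ε : L → Bool, (signedAdj e ε ^ (2 * p)) x x
      ≤ 𝔼 ε : L → Bool, ∑ a ∈ T, ∑ b ∈ T, 4 ^ (2 * p) *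
      F a b ε ^ (2 * p) :=
        Finset.expect_le_expect fun ε _ => hpt ε
    _ = ∑ a ∈ T, ∑ b ∈ T, 4 ^ (2 * p) * 𝔼 ε : L → Bool,
      F a b ε ^ (2 * p) := by
        rw [Finset.expect_sum_comm]
        refine Finset.sum_congr rfl fun a _ => ?_
        rw [Finset.expect_sum_comm]
        exact Finset.sum_congr rfl fun b _ => (Finset.mul_expect _ _ _).symm
    _ ≤ ∑ a ∈ T, ∑ b ∈ T, 4 ^ (2 * p) * (24 * p * M : ℝ) ^ p := by
        gcongr with a ha b hb
        exact expect_sgn_sum_pow_le _ hp hM1 (sum_sq_coeff_le e hM a b (hT1 a ha) (hT1 b hb))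
    _ = (T.card : ℝ) * T.card * (4 ^ (2 * p) * (24 * p * M : ℝ) ^ p) := by
        simp [mul_assoc]
    _ ≤ (5 ^ (3 * p) : ℝ) * 5 ^ (3 * p) * (4 ^ (2 * p) * (24 * p * M : ℝ) ^ p) := by
        gcongr <;> exact_mod_cast hTc
    _ = (6000000 * (p * M) : ℝ) ^ p := by
        simp only [pow_mul, ← mul_pow]
        congr 1
        ring

/-- Trace moments of a signed adjacency matrix whose multiplicities are at most `M` and whose
degrees are at most `p * M`. The walks are compared with those of the complete multigraph on
`3 * p` vertices: a walk of length `2 * p` leaves at least `p` of them free at each step. -/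
theorem expect_trace_pow_le (e : L → Sym2 V) {M p : ℕ} (hp : 1 ≤ p) (hM1 : 1 ≤ M)
    (hM : ∀ z, ({l | e l = z} : Finset L).card ≤ M)
    (hdeg : ∀ x, ∑ y, ({l | e l = s(x, y)} : Finset L).card ≤ p * M) :
    𝔼 ε : L → Bool, (signedAdj e ε ^ (2 * p)).trace ≤
      Fintype.card V * (6000000 * (p * M) : ℝ) ^ p := by
  let e' : Sym2 (Fin (3 * p)) × Fin M → Sym2 (Fin (3 * p)) := Prod.fst
  have hfib : ∀ z, ({l' | e' l' = z} : Finset (Sym2 (Fin (3 * p)) × Fin M)).card = M := by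
    intro z
    have : ({l' | e' l' = z} : Finset (Sym2 (Fin (3 * p)) × Fin M)) = {z} ×ˢ univ := by
      ext ⟨a, b⟩; simp [e', eq_comm]
    rw [this, Finset.card_product]; simp
  let x₀ : Fin (3 * p) := ⟨0, by omega⟩
  have hone : ∀ x, 𝔼 ε : L → Bool, (signedAdj e ε ^ (2 * p)) x x ≤
      (6000000 * (p * M) : ℝ) ^ p := by
    intro x
    have h1 := walkWeight_le e e' (2 * p) (fun z z' => (hM z).trans (hfib z').ge)
      (fun x x' W hW => by
        refine (hdeg x).trans ?_
        simp only [hfib, Finset.sum_const, smul_eq_mul, Finset.card_compl, Fintype.card_fin]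
        exact Nat.mul_le_mul_right _ (by omega))
      (2 * p) {x} [] (fun _ => x₀)
      (fun _ => (s(x₀, x₀), ⟨0, hM1⟩)) x x
      ⟨by simp, by simp, by simp, by simp⟩ (by simp) (by simp) (by simp; omega)
    simp only [walkWeight, List.map_nil, List.prod_nil, one_mul] at h1
    exact h1.trans (expect_signedAdj_pow_le_of_card e' hp hM1 (by simp)
      (fun z => (hfib z).le) x₀)
  simp only [Matrix.trace, Matrix.diag_apply]
  rw [Finset.expect_sum_comm]
  refine (Finset.sum_le_sum fun x _ => hone x).trans ?_
  simp

end model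

/-! ### Trace duality -/

section spectral
variable {V L : Type*} [Fintype V] [DecidableEq V] [Fintype L]

lemma isHermitian_signedAdj {V L : Type*} [DecidableEq V] [Fintype L] (e : L → Sym2 V) (ε : L → Bool) :
    (signedAdj e ε).IsHermitian := by
  ext x y
  simp [signedAdj, Sym2.eq_swap (a := x)]

/-- Trace duality, with the operator norm replaced by a trace moment. The inequality
`t ≤ κ (1 + (t / κ) ^ (2 p))` stands in for taking the `2p`-th root. -/
lemma abs_trace_mul_le {X G : Matrix V V ℝ} (hX : X.IsHermitian) (hG : G.PosSemidef) {p : ℕ}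
    (hp : 1 ≤ p) {κ : ℝ} (hκ : 0 < κ) :
    |(X * G).trace| ≤ κ * (1 + (X ^ (2 * p)).trace / κ ^ (2 * p)) * G.trace := by
  set U : Matrix V V ℝ := (hX.eigenvectorUnitary : Matrix V V ℝ) with hU
  set D : Matrix V V ℝ := Matrix.diagonal hX.eigenvalues with hD
  have hUU : star U * U = 1 := Unitary.coe_star_mul_self hX.eigenvectorUnitary
  have hUU' : U * star U = 1 := Unitary.coe_mul_star_self hX.eigenvectorUnitary
  have hspec : X = U * D * star U := by
    have := hX.spectral_theorem
    rw [Unitary.conjStarAlgAut_apply] at this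
    exact this
  have hpow : ∀ n : ℕ, X ^ n = U * D ^ n * star U := by
    intro n
    induction n with
    | zero => simp [hUU']
    | succ n ih =>
      rw [pow_succ, ih, hspec, pow_succ]
      simp only [Matrix.mul_assoc]
      rw [← Matrix.mul_assoc (star U) U, hUU, Matrix.one_mul]
  set H : Matrix V V ℝ := star U * G * U with hH
  have hHpos : H.PosSemidef := by
    have := hG.conjTranspose_mul_mul_same U
    rwa [← Matrix.star_eq_conjTranspose] at this
  have htrG : H.trace = G.trace := by
    rw [hH, Matrix.trace_mul_comm, ← Matrix.mul_assoc, hUU', Matrix.one_mul]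
  have htrX : (X ^ (2 * p)).trace = ∑ i, hX.eigenvalues i ^ (2 * p) := by
    rw [hpow, Matrix.trace_mul_comm, ← Matrix.mul_assoc, hUU, Matrix.one_mul, hD,
      Matrix.diagonal_pow, Matrix.trace_diagonal]
    rfl
  have htrXG : (X * G).trace = ∑ i, hX.eigenvalues i * H i i := by
    have h1 : (X * G).trace = (D * H).trace := by
      conv_lhs => rw [hspec]
      rw [Matrix.mul_assoc, Matrix.mul_assoc, Matrix.trace_mul_comm, Matrix.mul_assoc, ← hH]
    rw [h1, hD]
    simp only [Matrix.trace, Matrix.diag_apply, Matrix.diagonal_mul]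
  have heig : ∀ i, |hX.eigenvalues i| ≤ κ * (1 + (X ^ (2 * p)).trace / κ ^ (2 * p)) := by
    intro i
    have h1 : hX.eigenvalues i ^ (2 * p) ≤ (X ^ (2 * p)).trace := by
      rw [htrX]
      exact Finset.single_le_sum (f := fun i => hX.eigenvalues i ^ (2 * p))
        (fun j _ => (even_two_mul p).pow_nonneg _) (Finset.mem_univ i)
    have h2 : |hX.eigenvalues i| / κ ≤ 1 + (|hX.eigenvalues i| / κ) ^ (2 * p) := by
      have hnn : 0 ≤ |hX.eigenvalues i| / κ := by positivity
      rcases le_total (|hX.eigenvalues i| / κ) 1 with h | h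
      · have := pow_nonneg hnn (2 * p)
        linarith
      · have := le_self_pow₀ h (show 2 * p ≠ 0 by omega)
        linarith
    rw [div_pow, (even_two_mul p).pow_abs] at h2
    calc |hX.eigenvalues i| = κ * (|hX.eigenvalues i| / κ) := by field_simp
      _ ≤ κ * (1 + hX.eigenvalues i ^ (2 * p) / κ ^ (2 * p)) := by gcongr
      _ ≤ _ := by gcongr
  have htr : G.trace = ∑ i, H i i := by rw [← htrG]; rfl
  rw [htrXG, htr, Finset.mul_sum]
  refine (Finset.abs_sum_le_sum_abs _ _).trans (Finset.sum_le_sum fun i _ => ?_)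
  rw [abs_mul, abs_of_nonneg hHpos.diag_nonneg]
  exact mul_le_mul_of_nonneg_right (heig i) hHpos.diag_nonneg

lemma trace_pow_even_nonneg {X : Matrix V V ℝ} (hX : X.IsHermitian) (p : ℕ) :
    0 ≤ (X ^ (2 * p)).trace := by
  rw [two_mul, pow_add]
  have := (Matrix.posSemidef_conjTranspose_mul_self (X ^ p)).trace_nonneg
  rwa [(hX.pow p).eq] at this

/-- The expected dual norm of a signed adjacency matrix over positive semidefinite matrices of
bounded trace. The condition on `|V|` absorbs the dimension into the constant `3 * 6000000`. -/
theorem expect_abs_trace_signedAdj_mul_le [DecidableEq L] (e : L → Sym2 V) {M p : ℕ} (hp : 1 ≤ p)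
    (hM1 : 1 ≤ M) (hM : ∀ z, ({l | e l = z} : Finset L).card ≤ M)
    (hdeg : ∀ x, ∑ y, ({l | e l = s(x, y)} : Finset L).card ≤ p * M)
    (hV : (Fintype.card V : ℝ) ≤ 3 * 3 ^ p) {τ : ℝ} (G : (L → Bool) → Matrix V V ℝ)
    (hG : ∀ ε, (G ε).PosSemidef) (hτ : ∀ ε, (G ε).trace ≤ τ) :
    𝔼 ε : L → Bool, |(signedAdj e ε * G ε).trace| ≤ 4 * √(18000000 * (p * M)) * τ := by
  have hp' : (1 : ℝ) ≤ p := by exact_mod_cast hp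
  have hM' : (1 : ℝ) ≤ M := by exact_mod_cast hM1
  set κ : ℝ := √(18000000 * (p * M)) with hκ
  have hκ0 : 0 < κ := Real.sqrt_pos.2 (by positivity)
  have hκ2 : κ ^ (2 * p) = (18000000 * (p * M) : ℝ) ^ p := by
    rw [pow_mul, hκ, Real.sq_sqrt (by positivity)]
  have hτ0 : 0 ≤ τ := (hG fun _ => true).trace_nonneg.trans (hτ _)
  have hκp : 0 < κ ^ (2 * p) := by positivity
  calc 𝔼 ε : L → Bool, |(signedAdj e ε * G ε).trace|
      ≤ 𝔼 ε : L → Bool, (κ * τ + κ * τ / κ ^ (2 * p) * (signedAdj e ε ^ (2 * p)).trace) := by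
        refine Finset.expect_le_expect fun ε _ => ?_
        refine (abs_trace_mul_le (isHermitian_signedAdj e ε) (hG ε) hp hκ0).trans ?_
        have h0 := trace_pow_even_nonneg (isHermitian_signedAdj e ε) p
        calc _ ≤ κ * (1 + (signedAdj e ε ^ (2 * p)).trace / κ ^ (2 * p)) * τ := by
              gcongr
              exact hτ ε
          _ = _ := by ring
    _ = κ * τ + κ * τ / κ ^ (2 * p) * 𝔼 ε : L → Bool, (signedAdj e ε ^ (2 * p)).trace := by
        rw [Finset.expect_add_distrib, Fintype.expect_const, Finset.mul_expect]
    _ ≤ κ * τ + κ * τ / κ ^ (2 * p) * (3 * κ ^ (2 * p)) := by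
        gcongr
        refine (expect_trace_pow_le e hp hM1 hM hdeg).trans ?_
        rw [hκ2]
        calc (Fintype.card V : ℝ) * (6000000 * (p * M)) ^ p
            ≤ 3 * 3 ^ p * (6000000 * (p * M)) ^ p := by gcongr
          _ = 3 * (18000000 * (p * M)) ^ p := by
              rw [mul_assoc, ← mul_pow]; ring
    _ = 4 * κ * τ := by field_simp; ring

end spectral

/-! ### Contraction, symmetrization and sampling without replacement -/

section contraction
variable {L 𝒳 : Type*} [Fintype L] [DecidableEq L]

/-- The sign vector `ε` with the sign at `l` reversed. -/
def flipAt {L : Type*} [DecidableEq L] (l : L) (ε : L → Bool) : L → Bool :=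
  Function.update ε l (!ε l)

lemma flipAt_flipAt {L : Type*} [DecidableEq L] (l : L) (ε : L → Bool) :
    flipAt l (flipAt l ε) = ε := by
  simp [flipAt]

lemma expect_flipAt (l : L) (F : (L → Bool) → ℝ) : 𝔼 ε, F (flipAt l ε) = 𝔼 ε, F ε :=
  Fintype.expect_equiv (Function.Involutive.toPerm (flipAt l) (flipAt_flipAt l)) _ _ fun _ => rfl

/-- Contraction principle for Rademacher averages. A supremum over `𝒳` of a random function is
expressed as the average along an arbitrary choice `x` of a point of `𝒳` for every outcome. -/
theorem contraction (f g : 𝒳 → L → ℝ) (hfg : ∀ x y l, |f x l - f y l| ≤ |g x l - g y l|) {R : ℝ}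
    (hR : ∀ x : (L → Bool) → 𝒳, 𝔼 ε, ∑ l, sgn (ε l) * g (x ε) l ≤ R) (x : (L → Bool) → 𝒳) :
    𝔼 ε, ∑ l, sgn (ε l) * f (x ε) l ≤ R := by
  classical
  -- Coordinates in `S` carry `f`, the others `g`; coordinates are exchanged one at a time.
  suffices h : ∀ S : Finset L, ∀ x : (L → Bool) → 𝒳,
      𝔼 ε, ∑ l, sgn (ε l) * (if l ∈ S then f (x ε) l else g (x ε) l) ≤ R by
    simpa using h univ x
  intro S
  induction S using Finset.induction_on with
  | empty => simpa using hR
  | insert l₀ S hl₀ ih =>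
    intro x
    let c : (L → Bool) → Prop := fun ε =>
      g (x (Function.update ε l₀ false)) l₀ ≤ g (x (Function.update ε l₀ true)) l₀
    let x' : (L → Bool) → 𝒳 := fun ε => if c ε then x ε else x (flipAt l₀ ε)
    let F : (L → Bool) → ℝ := fun ε =>
      ∑ l, sgn (ε l) * (if l ∈ insert l₀ S then f (x ε) l else g (x ε) l)
    let F' : (L → Bool) → ℝ := fun ε =>
      ∑ l, sgn (ε l) * (if l ∈ S then f (x' ε) l else g (x' ε) l)
    let rest : (L → Bool) → 𝒳 → ℝ := fun ε y =>
      ∑ l ∈ univ.erase l₀, sgn (ε l) * (if l ∈ S then f y l else g y l)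
    have hrest : ∀ ε y, rest (flipAt l₀ ε) y = rest ε y := by
      intro ε y
      refine Finset.sum_congr rfl fun l hl => ?_
      rw [flipAt, Function.update_of_ne (Finset.ne_of_mem_erase hl)]
    have hF : ∀ ε, F ε = sgn (ε l₀) * f (x ε) l₀ + rest ε (x ε) := by
      intro ε
      simp only [F, rest]
      rw [← Finset.add_sum_erase _ _ (Finset.mem_univ l₀), if_pos (Finset.mem_insert_self _ _)]
      congr 1
      refine Finset.sum_congr rfl fun l hl => ?_
      simp [Finset.ne_of_mem_erase hl]
    have hF' : ∀ ε, F' ε = sgn (ε l₀) * g (x' ε) l₀ + rest ε (x' ε) := by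
      intro ε
      simp only [F', rest]
      rw [← Finset.add_sum_erase _ _ (Finset.mem_univ l₀), if_neg hl₀]
    have htrue : ∀ ε, ε l₀ = true → F ε + F (flipAt l₀ ε) ≤ F' ε + F' (flipAt l₀ ε) := by
      intro ε hε
      have hflip : flipAt l₀ ε l₀ = false := by simp [flipAt, hε]
      have hc : c (flipAt l₀ ε) ↔ c ε := by simp [c, flipAt]
      have hup : Function.update ε l₀ true = ε := by rw [← hε]; exact Function.update_eq_self _ _
      have hup' : Function.update ε l₀ false = flipAt l₀ ε := by simp [flipAt, hε]
      have habs := abs_le.1 (hfg (x ε) (x (flipAt l₀ ε)) l₀)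
      rw [hF, hF, hF', hF', hrest, hrest, hε, hflip]
      by_cases h : c ε
      · have hx1 : x' ε = x ε := if_pos h
        have hx2 : x' (flipAt l₀ ε) = x (flipAt l₀ ε) := if_pos (hc.2 h)
        have h' : g (x (flipAt l₀ ε)) l₀ ≤ g (x ε) l₀ := by
          have := h; simp only [c, hup, hup'] at this; exact this
        rw [abs_of_nonneg (sub_nonneg.2 h')] at habs
        rw [hx1, hx2, sgn_true, sgn_false]
        linarith [habs.2]
      · have hx1 : x' ε = x (flipAt l₀ ε) := if_neg h
        have hx2 : x' (flipAt l₀ ε) = x ε := by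
          simp only [x']; rw [if_neg (fun h' => h (hc.1 h')), flipAt_flipAt]
        have h' : g (x ε) l₀ < g (x (flipAt l₀ ε)) l₀ := by
          have := h; simp only [c, hup, hup', not_le] at this; exact this
        rw [abs_of_neg (sub_neg.2 h')] at habs
        rw [hx1, hx2, sgn_true, sgn_false]
        linarith [habs.2]
    have hpair : ∀ ε, F ε + F (flipAt l₀ ε) ≤ F' ε + F' (flipAt l₀ ε) := by
      intro ε
      cases hε : ε l₀ with
      | true => exact htrue ε hε
      | false =>
        have := htrue (flipAt l₀ ε) (by simp [flipAt, hε])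
        rw [flipAt_flipAt] at this
        linarith
    have hsum : 𝔼 ε, F ε + 𝔼 ε, F ε ≤ 𝔼 ε, F' ε + 𝔼 ε, F' ε := by
      nth_rewrite 2 [← expect_flipAt l₀ F]
      nth_rewrite 2 [← expect_flipAt l₀ F']
      rw [← Finset.expect_add_distrib, ← Finset.expect_add_distrib]
      exact Finset.expect_le_expect fun ε _ => hpair ε
    have hih : 𝔼 ε, F' ε ≤ R := ih x'
    change 𝔼 ε, F ε ≤ R
    linarith

end contraction

section symmetrization
variable {T 𝒳 : Type*} [Fintype T]

lemma expect_apply {L : Type*} [Fintype L] [DecidableEq L] [Nonempty T] (l : L) (g : T → ℝ) :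
    𝔼 t : L → T, g (t l) = 𝔼 s, g s := by
  have h := expect_pi_prod (L := L) (T := T) fun l' s => if l' = l then g s else 1
  simp only [Finset.prod_ite_eq', Finset.mem_univ, if_true] at h
  rw [h]
  calc ∏ l', 𝔼 s, (if l' = l then g s else 1) = ∏ l', if l' = l then 𝔼 s, g s else 1 := by
        refine Finset.prod_congr rfl fun l' _ => ?_
        split_ifs
        · rfl
        · exact Fintype.expect_const _
    _ = _ := by simp

lemma expect_prod_type {A B : Type*} [Fintype A] [Fintype B] (F : A → B → ℝ) :
    𝔼 q : A × B, F q.1 q.2 = 𝔼 a, 𝔼 b, F a b := by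
  rw [← Finset.univ_product_univ]
  exact Finset.expect_product' _ _ _

/-- Symmetrization for `m` independent uniform samples, along arbitrary choices `x`. -/
theorem symmetrization [Nonempty T] {m : ℕ} (f : 𝒳 → T → ℝ) (Q : (Fin m → T) → ℝ)
    (hQ : ∀ (t : Fin m → T) (y : (Fin m → Bool) → 𝒳),
      𝔼 ε, ∑ l, sgn (ε l) * f (y ε) (t l) ≤ Q t) (x : (Fin m → T) → 𝒳) :
    𝔼 t : Fin m → T, ∑ l, (f (x t) (t l) - 𝔼 s, f (x t) s) ≤ 2 * 𝔼 t, Q t := by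
  classical
  let H : (Fin m → T) × (Fin m → T) → ℝ := fun q =>
    ∑ l, (f (x q.1) (q.1 l) - f (x q.1) (q.2 l))
  -- exchange of the two samples at the positions with a negative sign
  let sw : (Fin m → Bool) → (Fin m → T) × (Fin m → T) → (Fin m → T) × (Fin m → T) := fun ε q =>
    (fun l => if ε l then q.1 l else q.2 l, fun l => if ε l then q.2 l else q.1 l)
  have hsw : ∀ ε, Function.Involutive (sw ε) := by
    intro ε q
    ext l <;> simp only [sw] <;> split_ifs <;> rfl
  have hH : 𝔼 t : Fin m → T, ∑ l, (f (x t) (t l) - 𝔼 s, f (x t) s) = 𝔼 q, H q := by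
    have hprod : 𝔼 q, H q = 𝔼 t : Fin m → T, 𝔼 t' : Fin m → T,
        ∑ l, (f (x t) (t l) - f (x t) (t' l)) :=
      expect_prod_type fun t t' : Fin m → T => ∑ l, (f (x t) (t l) - f (x t) (t' l))
    rw [hprod]
    refine Finset.expect_congr rfl fun t _ => ?_
    rw [Finset.expect_sum_comm]
    refine Finset.sum_congr rfl fun l _ => ?_
    rw [Finset.expect_sub_distrib, Fintype.expect_const, expect_apply l (f (x t))]
  have hHsw : ∀ ε, 𝔼 q, H q = 𝔼 q, H (sw ε q) := fun ε =>
    Fintype.expect_equiv (hsw ε).toPerm _ _ fun q => by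
      rw [Function.Involutive.coe_toPerm, hsw ε q]
  have hHval : ∀ ε q, H (sw ε q) = ∑ l, sgn (ε l) * f (x (sw ε q).1) (q.1 l) -
      ∑ l, sgn (ε l) * f (x (sw ε q).1) (q.2 l) := by
    intro ε q
    rw [← Finset.sum_sub_distrib]
    refine Finset.sum_congr rfl fun l _ => ?_
    cases hε : ε l with
    | true => simp [sw, hε]
    | false => simp [sw, hε]; ring
  have hneg : ∀ (t : Fin m → T) (y : (Fin m → Bool) → 𝒳),
      -Q t ≤ 𝔼 ε, ∑ l, sgn (ε l) * f (y ε) (t l) := by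
    intro t y
    have h1 := hQ t fun ε => y fun l => !(ε l)
    have h2 : 𝔼 ε : Fin m → Bool, ∑ l, sgn (ε l) * f (y fun l => !(ε l)) (t l) =
        𝔼 ε, -∑ l, sgn (ε l) * f (y ε) (t l) := by
      have hinv : Function.Involutive fun (ε : Fin m → Bool) l => !(ε l) := fun ε => by simp
      refine Fintype.expect_equiv hinv.toPerm _ _ fun ε => ?_
      rw [Function.Involutive.coe_toPerm, ← Finset.sum_neg_distrib]
      exact Finset.sum_congr rfl fun l _ => by simp
    rw [h2, Finset.expect_neg_distrib] at h1
    linarith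
  calc 𝔼 t : Fin m → T, ∑ l, (f (x t) (t l) - 𝔼 s, f (x t) s)
      = 𝔼 ε : Fin m → Bool, 𝔼 q, H q := by rw [hH, Fintype.expect_const]
    _ = 𝔼 ε : Fin m → Bool, 𝔼 q, H (sw ε q) := Finset.expect_congr rfl fun ε _ => hHsw ε
    _ = 𝔼 q, 𝔼 ε : Fin m → Bool, H (sw ε q) := Finset.expect_comm _ _ _
    _ ≤ 𝔼 q : (Fin m → T) × (Fin m → T), (Q q.1 + Q q.2) := by
        refine Finset.expect_le_expect fun q _ => ?_
        simp_rw [hHval]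
        rw [Finset.expect_sub_distrib]
        have h1 := hQ q.1 fun ε => x (sw ε q).1
        have h2 := hneg q.2 fun ε => x (sw ε q).1
        linarith
    _ = 2 * 𝔼 t, Q t := by
        rw [expect_prod_type fun t t' => Q t + Q t']
        simp only [Finset.expect_add_distrib, Fintype.expect_const]
        ring

end symmetrization

section withoutReplacement
variable {T 𝒳 : Type*} [Fintype T] [DecidableEq T]

/-- A uniformly random permutation carries a fixed set to a uniformly random set of its size. -/
lemma expect_perm_image (D : Finset T) (F : Finset T → ℝ) :
    𝔼 π : Equiv.Perm T, F (D.image π) = 𝔼 Ω ∈ powersetCard D.card univ, F Ω := by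
  have hconst : ∀ D' ∈ powersetCard D.card (univ : Finset T),
      𝔼 π : Equiv.Perm T, F (D'.image π) = 𝔼 π : Equiv.Perm T, F (D.image π) := by
    intro D' hD'
    have hc : D.card = D'.card := (Finset.mem_powersetCard.1 hD').2.symm
    let τ : Equiv.Perm T := (Finset.equivOfCardEq hc).extendSubtype
    have hτ : D.image τ = D' := by
      refine Finset.eq_of_subset_of_card_le ?_ ?_
      · intro a ha
        obtain ⟨b, hb, rfl⟩ := Finset.mem_image.1 ha
        exact (Finset.equivOfCardEq hc).extendSubtype_mem b hb
      · rw [Finset.card_image_of_injective _ τ.injective, hc]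
    refine Fintype.expect_equiv (Equiv.mulRight τ) _ _ fun π => ?_
    rw [← hτ, Finset.image_image]
    rfl
  have hne : (powersetCard D.card (univ : Finset T)).Nonempty :=
    ⟨D, Finset.mem_powersetCard.2 ⟨Finset.subset_univ _, rfl⟩⟩
  calc 𝔼 π : Equiv.Perm T, F (D.image π)
      = 𝔼 D' ∈ powersetCard D.card (univ : Finset T), 𝔼 π : Equiv.Perm T, F (D.image π) :=
        (Finset.expect_const hne _).symm
    _ = 𝔼 D' ∈ powersetCard D.card (univ : Finset T), 𝔼 π : Equiv.Perm T, F (D'.image π) :=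
        Finset.expect_congr rfl fun D' hD' => (hconst D' hD').symm
    _ = 𝔼 π : Equiv.Perm T, 𝔼 D' ∈ powersetCard D.card (univ : Finset T), F (D'.image π) :=
        Finset.expect_comm _ _ _
    _ = 𝔼 π : Equiv.Perm T, 𝔼 Ω ∈ powersetCard D.card (univ : Finset T), F Ω := by
        refine Finset.expect_congr rfl fun π _ => ?_
        refine Finset.expect_nbij' (fun D' => D'.image π) (fun D' => D'.image π.symm)
          ?_ ?_ ?_ ?_ ?_
        · intro a ha
          rw [Finset.mem_powersetCard] at ha ⊢
          exact ⟨Finset.subset_univ _, by rw [Finset.card_image_of_injective _ π.injective, ha.2]⟩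
        · intro a ha
          rw [Finset.mem_powersetCard] at ha ⊢
          exact ⟨Finset.subset_univ _,
            by rw [Finset.card_image_of_injective _ π.symm.injective, ha.2]⟩
        · intro a _; simp [Finset.image_image]
        · intro a _; simp [Finset.image_image]
        · intro a _; rfl
    _ = _ := Fintype.expect_const _

/-- Hoeffding's reduction of sampling without replacement to sampling with replacement. A sample
`Y` with replacement is completed to a set `D Y` of `m` elements; a uniformly random permutation
`π` makes `π (D Y)` a uniformly random set and, by symmetry, every `π (Y l)` a uniformly random
element of it. -/
theorem expect_powersetCard_le {m : ℕ} (hm : 1 ≤ m) (hmT : m ≤ Fintype.card T)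
    (g : 𝒳 → T → ℝ) {Q : ℝ}
    (hQ : ∀ x : (Fin m → T) → 𝒳, 𝔼 t : Fin m → T, ∑ l, g (x t) (t l) ≤ Q) (x : Finset T → 𝒳) :
    𝔼 Ω ∈ powersetCard m (univ : Finset T), ∑ ω ∈ Ω, g (x Ω) ω ≤ Q := by
  have hT : Nonempty T := Fintype.card_pos_iff.1 (by omega)
  have hD : ∀ Y : Fin m → T, ∃ D : Finset T, univ.image Y ⊆ D ∧ D.card = m := by
    intro Y
    have hle : (univ.image Y).card ≤ m := Finset.card_image_le.trans (by simp)
    obtain ⟨D, h1, h2⟩ := Finset.exists_superset_card_eq hle hmT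
    exact ⟨D, h1, h2⟩
  choose D hYD hcard using hD
  have hsymm : ∀ (D : Finset T) (y y' : T), y ∈ D → y' ∈ D →
      𝔼 π : Equiv.Perm T, g (x (D.image π)) (π y) =
        𝔼 π : Equiv.Perm T, g (x (D.image π)) (π y') := by
    intro D y y' hy hy'
    refine Fintype.expect_equiv (Equiv.mulRight (Equiv.swap y y')) _ _ fun π => ?_
    have hswap : D.image (Equiv.swap y y') = D := by
      refine Finset.eq_of_subset_of_card_le ?_
        (Finset.card_image_of_injective _ (Equiv.injective _)).ge
      intro a ha
      obtain ⟨b, hb, rfl⟩ := Finset.mem_image.1 ha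
      rw [Equiv.swap_apply_def]
      split_ifs <;> assumption
    have h1 : D.image (Equiv.mulRight (Equiv.swap y y') π) = D.image π := by
      conv_rhs => rw [← hswap, Finset.image_image]
      rfl
    rw [h1]
    simp
  have hY : ∀ Y : Fin m → T, 𝔼 Ω ∈ powersetCard m (univ : Finset T), ∑ ω ∈ Ω, g (x Ω) ω =
      𝔼 π : Equiv.Perm T, ∑ l, g (x ((D Y).image π)) (π (Y l)) := by
    intro Y
    have h1 := expect_perm_image (D Y) fun Ω => ∑ ω ∈ Ω, g (x Ω) ω
    rw [hcard] at h1
    rw [← h1, Finset.expect_sum_comm]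
    simp_rw [Finset.sum_image (Equiv.injective _).injOn]
    rw [Finset.expect_sum_comm]
    have hl : ∀ l, Y l ∈ D Y := fun l => hYD Y (Finset.mem_image_of_mem _ (Finset.mem_univ l))
    let l₀ : Fin m := ⟨0, hm⟩
    rw [Finset.sum_congr rfl fun y hy => hsymm (D Y) y (Y l₀) hy (hl l₀),
      Finset.sum_congr rfl fun l _ => hsymm (D Y) (Y l) (Y l₀) (hl l) (hl l₀)]
    simp [hcard]
  calc 𝔼 Ω ∈ powersetCard m (univ : Finset T), ∑ ω ∈ Ω, g (x Ω) ω
      = 𝔼 Y : Fin m → T, 𝔼 Ω ∈ powersetCard m (univ : Finset T), ∑ ω ∈ Ω, g (x Ω) ω :=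
        (Fintype.expect_const _).symm
    _ = 𝔼 Y : Fin m → T, 𝔼 π : Equiv.Perm T, ∑ l, g (x ((D Y).image π)) (π (Y l)) :=
        Finset.expect_congr rfl fun Y _ => hY Y
    _ = 𝔼 π : Equiv.Perm T, 𝔼 Y : Fin m → T, ∑ l, g (x ((D Y).image π)) (π (Y l)) :=
        Finset.expect_comm _ _ _
    _ ≤ Q := by
        refine Finset.expect_le Finset.univ_nonempty fun π _ => ?_
        refine le_trans (le_of_eq ?_) (hQ fun Y' => x ((D (π.symm ∘ Y')).image π))
        refine Fintype.expect_equiv (Equiv.arrowCongr (Equiv.refl _) π) _ _ fun Y => ?_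
        have : π.symm ∘ (Equiv.arrowCongr (Equiv.refl _) π) Y = Y := by
          ext l; simp
        rw [this]
        rfl

end withoutReplacement

/-! ### Occupancy counts of random triples -/

section occupancy
variable {T J : Type*} [Fintype T] [Nonempty T] [Fintype J] [Nonempty J]

/-- Expected maximal occupancy: if each of the events `A j` has probability at most `q`, then the
largest number of hits among `m` independent samples has a mean of order
`(log |J| + m q exp θ) / θ`, for every `θ`. -/
lemma expect_max_count_le (A : J → T → Prop) [∀ j, DecidablePred (A j)] {m : ℕ} {q θ : ℝ}
    (hθ : 0 ≤ θ) (hA : ∀ j, 𝔼 s, (if A j s then (1 : ℝ) else 0) ≤ q) (Z : (Fin m → T) → ℕ)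
    (hZ : ∀ t, ∃ j, Z t ≤ ({l | A j (t l)} : Finset (Fin m)).card) :
    𝔼 t, θ * (Z t : ℝ) ≤ Real.log (Fintype.card J) + m * (q * Real.exp θ) + 1 := by
  set c : ℝ := Real.log (Fintype.card J) + m * (q * Real.exp θ) with hc
  have hJ : (0 : ℝ) < Fintype.card J := by exact_mod_cast Fintype.card_pos
  have hmgf : ∀ j, 𝔼 t : Fin m → T, Real.exp (θ * ({l | A j (t l)} : Finset (Fin m)).card) ≤
      Real.exp (m * (q * Real.exp θ)) := by
    intro j
    have h1 : ∀ t : Fin m → T, Real.exp (θ * ({l | A j (t l)} : Finset (Fin m)).card) =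
        ∏ l, (fun (_ : Fin m) s => if A j s then Real.exp θ else 1) l (t l) := by
      intro t
      rw [Finset.prod_ite, Finset.prod_const, Finset.prod_const_one, mul_one, mul_comm,
        Real.exp_nat_mul]
    simp_rw [h1]
    rw [expect_pi_prod (fun (_ : Fin m) s => if A j s then Real.exp θ else 1), Finset.prod_const,
      Finset.card_univ, Fintype.card_fin, Real.exp_nat_mul]
    have h2 : 𝔼 s, (if A j s then Real.exp θ else 1) ≤ Real.exp (q * Real.exp θ) := by
      calc 𝔼 s, (if A j s then Real.exp θ else 1)
          ≤ 𝔼 s, (1 + (if A j s then (1 : ℝ) else 0) * Real.exp θ) := by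
            refine Finset.expect_le_expect fun s _ => ?_
            split_ifs <;> linarith [Real.exp_pos θ]
        _ = 1 + (𝔼 s, (if A j s then (1 : ℝ) else 0)) * Real.exp θ := by
            rw [Finset.expect_add_distrib, Fintype.expect_const, Finset.expect_mul]
        _ ≤ 1 + q * Real.exp θ := by gcongr; exact hA j
        _ ≤ Real.exp (q * Real.exp θ) := by linarith [Real.add_one_le_exp (q * Real.exp θ)]
    refine pow_le_pow_left₀ (Finset.expect_nonneg fun s _ => ?_) h2 m
    split_ifs <;> positivity
  -- `x ≤ c + exp (x - c)` replaces the usual appeal to Jensen's inequality.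
  have hpt : ∀ t, θ * (Z t : ℝ) ≤
      c + ∑ j, Real.exp (-c) * Real.exp (θ * ({l | A j (t l)} : Finset (Fin m)).card) := by
    intro t
    obtain ⟨j, hj⟩ := hZ t
    have h1 : θ * (Z t : ℝ) ≤ θ * ({l | A j (t l)} : Finset (Fin m)).card := by gcongr
    have h2 := Real.add_one_le_exp (-c + θ * ({l | A j (t l)} : Finset (Fin m)).card)
    rw [Real.exp_add] at h2
    have h3 := Finset.single_le_sum (s := univ) (f := fun j => Real.exp (-c) *
      Real.exp (θ * ({l | A j (t l)} : Finset (Fin m)).card))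
      (fun j _ => by positivity) (Finset.mem_univ j)
    linarith
  calc 𝔼 t, θ * (Z t : ℝ) ≤ 𝔼 t : Fin m → T, (c + ∑ j, Real.exp (-c) *
        Real.exp (θ * ({l | A j (t l)} : Finset (Fin m)).card)) :=
        Finset.expect_le_expect fun t _ => hpt t
    _ = c + ∑ j, Real.exp (-c) * 𝔼 t : Fin m → T,
          Real.exp (θ * ({l | A j (t l)} : Finset (Fin m)).card) := by
        rw [Finset.expect_add_distrib, Fintype.expect_const, Finset.expect_sum_comm]
        simp_rw [Finset.mul_expect]
    _ ≤ c + ∑ _j : J, Real.exp (-c) * Real.exp (m * (q * Real.exp θ)) := by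
        gcongr with j _
        exact hmgf j
    _ = c + 1 := by
        rw [Finset.sum_const, Finset.card_univ, nsmul_eq_mul, ← Real.exp_add, hc, neg_add,
          neg_add_cancel_right, Real.exp_neg, Real.exp_log hJ, mul_inv_cancel₀ hJ.ne']

end occupancy

section triples
variable {d : ℕ}

lemma expect_triple_apply [NeZero d] (a : Fin 3) (i : Fin d) :
    𝔼 s : Triple d, (if s a = i then (1 : ℝ) else 0) = 1 / d := by
  have h := expect_apply (T := Fin d) a fun j => if j = i then (1 : ℝ) else 0
  rw [h, Fintype.expect_eq_sum_div_card]
  simp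

lemma expect_triple_apply_pair [NeZero d] {a b : Fin 3} (hab : a ≠ b) (i j : Fin d) :
    𝔼 s : Triple d, (if s a = i ∧ s b = j then (1 : ℝ) else 0) = 1 / d * (1 / d) := by
  have h := expect_pi_prod (L := Fin 3) (T := Fin d) fun l k =>
    if l = a then (if k = i then (1 : ℝ) else 0) else
      if l = b then (if k = j then (1 : ℝ) else 0) else 1
  have h1 : ∀ k : Fin d, 𝔼 s : Fin d, (if s = k then (1 : ℝ) else 0) = 1 / d := by
    intro k
    rw [Fintype.expect_eq_sum_div_card]; simp
  have h2 : ∀ F : Fin 3 → ℝ, (∀ l, l ≠ a → l ≠ b → F l = 1) → ∏ l, F l = F a * F b := by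
    intro F hF
    rw [← Finset.prod_pair hab]
    refine (Finset.prod_subset (Finset.subset_univ _) fun l _ hl => ?_).symm
    simp only [Finset.mem_insert, Finset.mem_singleton, not_or] at hl
    exact hF l hl.1 hl.2
  rw [h2 _ (fun l hla hlb => by simp [hla, hlb])] at h
  simp only [if_true, hab.symm, if_false, h1] at h
  rw [← h]
  refine Finset.expect_congr rfl fun s _ => ?_
  rw [h2 _ (fun l hla hlb => by simp [hla, hlb])]
  by_cases h3 : s a = i <;> by_cases h4 : s b = j <;> simp [h3, h4, hab.symm]

/-- The edge between the vertices of a sampled triple in the blocks `a` and `b`. -/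
def pairEdge {m : ℕ} (a b : Fin 3) (t : Fin m → Triple d) (l : Fin m) : Sym2 (Idx d) :=
  s((a, t l a), (b, t l b))

lemma pairEdge_eq_iff {m : ℕ} {a b : Fin 3} (hab : a ≠ b) (t : Fin m → Triple d) (l : Fin m)
    (i j : Fin d) : pairEdge a b t l = s((a, i), (b, j)) ↔ t l a = i ∧ t l b = j := by
  simp [pairEdge, hab, hab.symm]

lemma sum_card_pairEdge_le {m : ℕ} (a b : Fin 3) (t : Fin m → Triple d) (x : Idx d) :
    ∑ y, ({l | pairEdge a b t l = s(x, y)} : Finset (Fin m)).card ≤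
      ({l | t l x.1 = x.2} : Finset (Fin m)).card := by
  rw [← Finset.card_biUnion]
  · refine Finset.card_le_card fun l hl => ?_
    simp only [Finset.mem_biUnion, Finset.mem_filter, Finset.mem_univ, true_and] at hl ⊢
    obtain ⟨y, hy⟩ := hl
    have hx : x ∈ pairEdge a b t l := by rw [hy]; simp
    rw [pairEdge, Sym2.mem_iff] at hx
    rcases hx with rfl | rfl <;> rfl
  · intro y _ y' _ hyy'
    rw [Function.onFun, Finset.disjoint_left]
    intro l hl hl'
    simp only [Finset.mem_filter, Finset.mem_univ, true_and] at hl hl'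
    rw [hl] at hl'
    exact hyy' (Sym2.congr_right.1 hl')

/-- Jensen's inequality for the square root. -/
lemma expect_sqrt_le {ι : Type*} [Fintype ι] [Nonempty ι] (f : ι → ℝ) (hf : ∀ i, 0 ≤ f i) :
    𝔼 i, √(f i) ≤ √(𝔼 i, f i) := by
  refine Real.le_sqrt_of_sq_le ?_
  have h := Finset.expect_mul_sq_le_sq_mul_sq (univ : Finset ι) (fun i => √(f i)) fun _ => (1 : ℝ)
  simpa [Real.sq_sqrt (hf _), Fintype.expect_const] using h

/-- The dual norm bound for the pair graph of a sample of triples, and its mean. -/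
lemma exists_pairEdge_bound {m : ℕ} (hd : 1 ≤ d) (hm : 1 ≤ m) {a b : Fin 3} (hab : a ≠ b) :
    ∃ q : (Fin m → Triple d) → ℝ,
      (∀ (t : Fin m → Triple d) (τ : ℝ) (G : (Fin m → Bool) → Matrix (Idx d) (Idx d) ℝ),
        (∀ ε, (G ε).PosSemidef) → (∀ ε, (G ε).trace ≤ τ) →
        𝔼 ε, |(signedAdj (pairEdge a b t) ε * G ε).trace| ≤ q t * τ) ∧
      𝔼 t, q t ≤ 100000 * √(Real.log d + m / d) := by
  have : NeZero d := ⟨by omega⟩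
  have hd0 : (1 : ℝ) ≤ d := by exact_mod_cast hd
  have hm0 : (1 : ℝ) ≤ m := by exact_mod_cast hm
  have hlog : 0 ≤ Real.log d := Real.log_nonneg hd0
  let deg : (Fin m → Triple d) → Idx d → ℕ := fun t x =>
    ({l | t l x.1 = x.2} : Finset (Fin m)).card
  let mult : (Fin m → Triple d) → Fin d × Fin d → ℕ := fun t z =>
    ({l | t l a = z.1 ∧ t l b = z.2} : Finset (Fin m)).card
  let R : (Fin m → Triple d) → ℕ := fun t => univ.sup (deg t)
  let M : (Fin m → Triple d) → ℕ := fun t => univ.sup (mult t)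
  -- the first two summands give `R ≤ p * M`, the last one `d ≤ 3 ^ p`
  let p : (Fin m → Triple d) → ℕ := fun t => R t / M t + 1 + ⌈Real.log d⌉₊
  have hR : ∀ t x, deg t x ≤ R t := fun t x => Finset.le_sup (f := deg t) (Finset.mem_univ x)
  have hM : ∀ t z, mult t z ≤ M t := fun t z => Finset.le_sup (f := mult t) (Finset.mem_univ z)
  have hM1 : ∀ t, 1 ≤ M t := by
    intro t
    refine le_trans ?_ (hM t (t ⟨0, hm⟩ a, t ⟨0, hm⟩ b))
    exact Finset.card_pos.2 ⟨⟨0, hm⟩, by simp⟩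
  have hMR : ∀ t, M t ≤ R t := fun t => Finset.sup_le fun z _ =>
    le_trans (Finset.card_le_card fun l hl => by
      simp only [Finset.mem_filter, Finset.mem_univ, true_and] at hl ⊢
      exact hl.1) (hR t (a, z.1))
  have hp : ∀ t, 1 ≤ p t := fun t =>
    (Nat.le_add_left 1 _).trans (Nat.le_add_right _ _)
  have hRp : ∀ t, R t ≤ p t * M t := by
    intro t
    have h1 := Nat.lt_div_mul_add (a := R t) (hM1 t)
    simp only [p]
    nlinarith [Nat.zero_le (⌈Real.log d⌉₊ * M t)]
  have hV : ∀ t, (Fintype.card (Idx d) : ℝ) ≤ 3 * 3 ^ p t := by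
    intro t
    have h1 : (d : ℝ) ≤ 3 ^ p t := by
      calc (d : ℝ) = Real.exp (Real.log d) := (Real.exp_log (by linarith)).symm
        _ ≤ Real.exp (p t) := by
            refine Real.exp_le_exp.2 ((Nat.le_ceil _).trans ?_)
            exact_mod_cast Nat.le_add_left _ _
        _ = Real.exp 1 ^ p t := by rw [← Real.exp_nat_mul, mul_one]
        _ ≤ 3 ^ p t := by gcongr; exact Real.exp_one_lt_three.le
    simpa using h1
  have hpM : ∀ t, (p t * M t : ℝ) ≤ 3 * R t + Real.log d * M t := by
    intro t
    have h1 : ((R t / M t : ℕ) : ℝ) * M t ≤ R t := by exact_mod_cast Nat.div_mul_le_self _ _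
    have h2 : (M t : ℝ) ≤ R t := by exact_mod_cast hMR t
    have h3 := (Nat.ceil_lt_add_one hlog).le
    have h4 : (0 : ℝ) ≤ M t := by positivity
    have h5 := mul_le_mul_of_nonneg_right h3 h4
    simp only [p, Nat.cast_add, Nat.cast_one]
    linarith
  have hER : 𝔼 t, (1 : ℝ) * (R t : ℝ) ≤ Real.log d + 3 * (m / d) + 3 := by
    have h := expect_max_count_le (T := Triple d) (J := Idx d) (fun x s => s x.1 = x.2) (m := m)
      (q := 1 / d) (θ := 1) zero_le_one (fun x => (expect_triple_apply x.1 x.2).le) R (fun t => by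
        obtain ⟨x, -, hx⟩ := Finset.exists_mem_eq_sup univ Finset.univ_nonempty (deg t)
        exact ⟨x, hx.le⟩)
    have h1 : Real.log (Fintype.card (Idx d)) ≤ 2 + Real.log d := by
      have : (Fintype.card (Idx d) : ℝ) = 3 * d := by simp
      rw [this, Real.log_mul (by norm_num) (by linarith)]
      have := Real.log_le_sub_one_of_pos (show (0 : ℝ) < 3 by norm_num)
      linarith
    have h2 : (m : ℝ) * (1 / d * Real.exp 1) ≤ 3 * (m / d) := by
      have h3 : (0 : ℝ) ≤ m / d := by positivity
      have h4 := mul_le_mul_of_nonneg_left Real.exp_one_lt_three.le h3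
      calc (m : ℝ) * (1 / d * Real.exp 1) = m / d * Real.exp 1 := by ring
        _ ≤ m / d * 3 := h4
        _ = _ := by ring
    linarith
  -- the choice `θ = log d` turns the exponential moment of the multiplicities into `m / d`
  have hEM : 𝔼 t, Real.log d * (M t : ℝ) ≤ 2 * Real.log d + m / d + 1 := by
    have h := expect_max_count_le (T := Triple d) (J := Fin d × Fin d)
      (fun z s => s a = z.1 ∧ s b = z.2) (m := m)
      (q := 1 / d * (1 / d)) (θ := Real.log d) hlog
      (fun z => (expect_triple_apply_pair hab z.1 z.2).le) M (fun t => by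
        obtain ⟨x, -, hx⟩ := Finset.exists_mem_eq_sup univ Finset.univ_nonempty (mult t)
        exact ⟨x, hx.le⟩)
    have h1 : Real.log (Fintype.card (Fin d × Fin d)) = 2 * Real.log d := by
      have : (Fintype.card (Fin d × Fin d) : ℝ) = d * d := by simp
      rw [this, Real.log_mul (by linarith) (by linarith)]
      ring
    have h2 : (m : ℝ) * (1 / d * (1 / d) * Real.exp (Real.log d)) = m / d := by
      rw [Real.exp_log (by linarith)]
      field_simp
    rw [h1, h2] at h
    exact h
  have hEpM : 𝔼 t, (p t * M t : ℝ) ≤ 25 * (Real.log d + m / d) := by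
    have h1 : 𝔼 t, (p t * M t : ℝ) ≤
        3 * 𝔼 t, (1 : ℝ) * (R t : ℝ) + 𝔼 t, Real.log d * (M t : ℝ) := by
      rw [Finset.mul_expect, ← Finset.expect_add_distrib]
      refine Finset.expect_le_expect fun t _ => ?_
      rw [one_mul]
      exact hpM t
    have h2 : 10 ≤ 20 * Real.log d + 10 * (m / d : ℝ) := by
      rcases Nat.lt_or_ge d 2 with h | h
      · have : d = 1 := by omega
        subst this
        simp
        linarith
      · have h3 : Real.log 2 ≤ Real.log d :=
          Real.log_le_log (by norm_num) (by exact_mod_cast h)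
        have h4 := Real.log_two_gt_d9
        have h5 : (0 : ℝ) ≤ m / d := by positivity
        linarith
    have h5 : (0 : ℝ) ≤ m / d := by positivity
    linarith
  refine ⟨fun t => 4 * √(18000000 * (p t * M t)), ?_, ?_⟩
  · intro t τ G hG hτ
    refine expect_abs_trace_signedAdj_mul_le (pairEdge a b t) (hp t) (hM1 t) ?_ ?_ (hV t) G hG hτ
    · intro z
      rcases Finset.eq_empty_or_nonempty ({l | pairEdge a b t l = z} : Finset (Fin m)) with h | h
      · rw [h]; simp
      · obtain ⟨l, hl⟩ := h
        have hz : pairEdge a b t l = z := (Finset.mem_filter.1 hl).2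
        refine le_trans (Finset.card_le_card fun l' hl' => ?_) (hM t (t l a, t l b))
        simp only [Finset.mem_filter, Finset.mem_univ, true_and] at hl' ⊢
        rw [← hz] at hl'
        exact (pairEdge_eq_iff hab t l' _ _).1 hl'
    · exact fun x => (sum_card_pairEdge_le a b t x).trans ((hR t x).trans (hRp t))
  · rw [← Finset.mul_expect]
    have h1 := expect_sqrt_le (fun t => 18000000 * (p t * M t : ℝ)) fun t => by positivity
    rw [← Finset.mul_expect] at h1
    have h2 : √(18000000 * 𝔼 t, (p t * M t : ℝ)) ≤ 25000 * √(Real.log d + m / d) := by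
      rw [show (25000 : ℝ) = √(25000 ^ 2) by rw [Real.sqrt_sq (by norm_num)],
        ← Real.sqrt_mul (by norm_num)]
      refine Real.sqrt_le_sqrt ?_
      have : 0 ≤ Real.log d + m / d := by positivity
      linarith
    linarith

end triples

/-! ### Linear forms over the constraint set -/

section forms
variable {d : ℕ}

lemma frobInner_sensing (K : Matrix (Fin 3) (Fin 3) ℝ) (t : Triple d)
    (Z : Matrix (Idx d) (Idx d) ℝ) :
    frobInner (sensing K t) Z = ∑ a, ∑ b, K a b * Z (a, t a) (b, t b) := by
  simp only [frobInner, Matrix.trace, Matrix.diag_apply, Matrix.mul_apply, Matrix.transpose_apply,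
    sensing, Matrix.of_apply, Fintype.sum_prod_type, ite_mul, zero_mul, ite_and]
  refine Finset.sum_congr rfl fun a _ => ?_
  rw [Finset.sum_eq_single (t a)]
  · simp
  · intro i _ hi; simp [hi]
  · simp

/-- The factor `2` comes from the two orientations of an edge between different blocks. -/
lemma trace_signedAdj_mul {m : ℕ} {a b : Fin 3} (hab : a ≠ b) (t : Fin m → Triple d)
    (ε : Fin m → Bool) {Z : Matrix (Idx d) (Idx d) ℝ} (hZ : Z.IsHermitian) :
    (signedAdj (pairEdge a b t) ε * Z).trace =
      2 * ∑ l, sgn (ε l) * Z (a, t l a) (b, t l b) := by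
  have hsymm : ∀ x y, Z x y = Z y x := fun x y => by simpa using hZ.apply y x
  have h1 : ∀ l, ∑ x, ∑ y, (if pairEdge a b t l = s(x, y) then sgn (ε l) * Z y x else 0) =
      2 * (sgn (ε l) * Z (a, t l a) (b, t l b)) := by
    intro l
    have hne : ((a, t l a), (b, t l b)) ≠ ((b, t l b), (a, t l a)) := by simp [hab]
    rw [← Fintype.sum_prod_type' fun x y =>
      if pairEdge a b t l = s(x, y) then sgn (ε l) * Z y x else 0, ← Finset.sum_filter]
    have h2 : ({q : Idx d × Idx d | pairEdge a b t l = s(q.1, q.2)} : Finset _) =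
        {((a, t l a), (b, t l b)), ((b, t l b), (a, t l a))} := by
      ext ⟨x, y⟩
      simp only [pairEdge, Finset.mem_filter, Finset.mem_univ, true_and, Finset.mem_insert,
        Finset.mem_singleton, Prod.mk.injEq (α := Idx d), Sym2.eq_iff]
      constructor
      · rintro (⟨rfl, rfl⟩ | ⟨rfl, rfl⟩) <;> simp
      · rintro (⟨rfl, rfl⟩ | ⟨rfl, rfl⟩) <;> simp
    rw [h2, Finset.sum_pair hne, hsymm (b, t l b) (a, t l a)]
    ring
  rw [Finset.mul_sum, ← Finset.sum_congr rfl fun l _ => h1 l, Finset.sum_comm]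
  simp only [Matrix.trace, Matrix.diag_apply, Matrix.mul_apply, signedAdj, Matrix.of_apply,
    Finset.sum_filter]
  refine Finset.sum_congr rfl fun x _ => ?_
  rw [Finset.sum_comm]
  refine Finset.sum_congr rfl fun y _ => ?_
  rw [Finset.sum_mul]
  exact Finset.sum_congr rfl fun l _ => by split_ifs <;> simp

/-- The entries of a positive semidefinite matrix are dominated by its diagonal. -/
lemma abs_le_of_mem_G {α : ℝ} {X : Matrix (Idx d) (Idx d) ℝ} (hX : X ∈ G d α) (x y : Idx d) :
    |X x y| ≤ 2 * α := by
  obtain ⟨hpos, -, hdiag⟩ := hX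
  have hsymm : X y x = X x y := by simpa using hpos.1.apply x y
  have h : ∀ c : ℝ, 0 ≤ X x x + 2 * c * X x y + c ^ 2 * X y y := by
    intro c
    have h1 := hpos.dotProduct_mulVec_nonneg (Pi.single x 1 + Pi.single y c)
    simp only [star_trivial, Matrix.mulVec_add, dotProduct_add, add_dotProduct,
      single_dotProduct, Matrix.mulVec_single, Pi.smul_apply, Matrix.col_apply,
      MulOpposite.op_one, one_smul, op_smul_eq_mul, one_mul, hsymm] at h1
    linarith
  have h1 := h 1
  have h2 := h (-1)
  rw [abs_le]
  constructor <;> linarith [hdiag x, hdiag y]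

lemma trueMatrix_mem_G {r : ℕ} {α : ℝ} (hα : 0 ≤ α) {A B C : Matrix (Fin d) (Fin r) ℝ}
    (hA : ∀ i, ‖WithLp.toLp 2 (A i)‖ ≤ √α) (hB : ∀ i, ‖WithLp.toLp 2 (B i)‖ ≤ √α)
    (hC : ∀ i, ‖WithLp.toLp 2 (C i)‖ ≤ √α) : trueMatrix A B C ∈ G d α := by
  have hrow : ∀ x : Idx d, ‖WithLp.toLp 2 (stack A B C x)‖ ≤ √α := by
    rintro ⟨k, i⟩
    fin_cases k
    · exact hA i
    · exact hB i
    · exact hC i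
  have hdiag : ∀ x, trueMatrix A B C x x ≤ α := by
    intro x
    have h1 : trueMatrix A B C x x = ‖WithLp.toLp 2 (stack A B C x)‖ ^ 2 := by
      rw [EuclideanSpace.real_norm_sq_eq, trueMatrix, Matrix.mul_apply]
      exact Finset.sum_congr rfl fun l _ => by rw [Matrix.transpose_apply, sq]
    rw [h1, ← Real.sq_sqrt hα]
    exact pow_le_pow_left₀ (norm_nonneg _) (hrow x) 2
  refine ⟨?_, ?_, fun x => (hdiag x).trans (by linarith)⟩
  · have := Matrix.posSemidef_self_mul_conjTranspose (stack A B C)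
    rwa [Matrix.conjTranspose_eq_transpose_of_trivial] at this
  · calc (trueMatrix A B C).trace ≤ ∑ _x : Idx d, α := Finset.sum_le_sum fun x _ => hdiag x
      _ = 3 * d * α := by simp
      _ ≤ 6 * d * α := by
        have : 0 ≤ d * α := by positivity
        linarith

lemma sum_sqrt_card_le {m : ℕ} (a : Fin 3) (t : Fin m → Triple d) :
    ∑ i, √(({l | t l a = i} : Finset (Fin m)).card : ℝ) ≤ √(d * m) := by
  refine Real.le_sqrt_of_sq_le ?_
  refine sq_sum_le_card_mul_sum_sq.trans ?_
  have h : ∑ i, ({l | t l a = i} : Finset (Fin m)).card = m := by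
    rw [← Finset.card_eq_sum_card_fiberwise (f := fun l => t l a) (t := univ) (by simp)]
    simp
  have h' : ∑ i, (({l | t l a = i} : Finset (Fin m)).card : ℝ) = m := by exact_mod_cast h
  simp only [Real.sq_sqrt (Nat.cast_nonneg _), h']
  simp

/-- The mean absolute value of a sum of independent signs, by its second moment. -/
lemma expect_abs_sgn_sum_le {L : Type*} [Fintype L] [DecidableEq L] (s : Finset L) :
    𝔼 ε : L → Bool, |∑ l ∈ s, sgn (ε l)| ≤ √s.card := by
  have hcross : ∀ l l' : L, 𝔼 ε : L → Bool, sgn (ε l) * sgn (ε l') = if l = l' then 1 else 0 := by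
    intro l l'
    have h := expect_list_sgn [l, l']
    simp only [List.map_cons, List.map_nil, List.prod_cons, List.prod_nil, mul_one] at h
    rw [h]
    refine if_congr ⟨fun h => ?_, fun h k => ?_⟩ rfl rfl
    · by_contra hne
      have := h l
      simp [Ne.symm hne] at this
    · subst h
      by_cases hk : l = k <;> simp [hk]
  have hsq : 𝔼 ε : L → Bool, (∑ l ∈ s, sgn (ε l)) ^ 2 = s.card := by
    simp_rw [sq, Finset.sum_mul_sum]
    rw [Finset.expect_sum_comm]
    simp_rw [Finset.expect_sum_comm, hcross]
    simp
  rw [← hsq]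
  have := expect_sqrt_le (fun ε : L → Bool => (∑ l ∈ s, sgn (ε l)) ^ 2) fun _ => sq_nonneg _
  simpa only [Real.sqrt_sq_eq_abs] using this

/-- Bound for the Rademacher average of one block of the sampled entries. In a diagonal block the
bound on the diagonal entries of `X` is used, in an off-diagonal block the trace bound. -/
lemma exists_block_bound {m : ℕ} (hd : 1 ≤ d) (hm : 1 ≤ m) {α : ℝ} (hα : 0 ≤ α) (a b : Fin 3) :
    ∃ q : (Fin m → Triple d) → ℝ,
      (∀ (t : Fin m → Triple d) (X : (Fin m → Bool) → Matrix (Idx d) (Idx d) ℝ),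
        (∀ ε, X ε ∈ G d α) →
        𝔼 ε, |∑ l, sgn (ε l) * X ε (a, t l a) (b, t l b)| ≤ q t) ∧
      𝔼 t, q t ≤ 300000 * d * α * √(Real.log d + m / d) := by
  have : NeZero d := ⟨by omega⟩
  have hd0 : (1 : ℝ) ≤ d := by exact_mod_cast hd
  have hlog : 0 ≤ Real.log d := Real.log_nonneg hd0
  by_cases hab : a = b
  · subst hab
    refine ⟨fun _ => 2 * α * √(d * m), fun t X hX => ?_, ?_⟩
    · have hpt : ∀ ε, |∑ l, sgn (ε l) * X ε (a, t l a) (a, t l a)| ≤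
          2 * α * ∑ i, |∑ l with t l a = i, sgn (ε l)| := by
        intro ε
        have h1 : ∑ l, sgn (ε l) * X ε (a, t l a) (a, t l a) =
            ∑ i, X ε (a, i) (a, i) * ∑ l with t l a = i, sgn (ε l) := by
          rw [← Finset.sum_fiberwise univ (fun l => t l a)]
          refine Finset.sum_congr rfl fun i _ => ?_
          rw [Finset.mul_sum]
          refine Finset.sum_congr rfl fun l hl => ?_
          rw [(Finset.mem_filter.1 hl).2, mul_comm]
        rw [h1, Finset.mul_sum]
        refine (Finset.abs_sum_le_sum_abs _ _).trans (Finset.sum_le_sum fun i _ => ?_)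
        rw [abs_mul]
        gcongr
        exact abs_le_of_mem_G (hX ε) _ _
      calc _ ≤ 𝔼 ε : Fin m → Bool, 2 * α * ∑ i, |∑ l with t l a = i, sgn (ε l)| :=
            Finset.expect_le_expect fun ε _ => hpt ε
        _ = 2 * α * ∑ i, 𝔼 ε : Fin m → Bool, |∑ l with t l a = i, sgn (ε l)| := by
            rw [← Finset.mul_expect, Finset.expect_sum_comm]
        _ ≤ 2 * α * ∑ i, √(({l | t l a = i} : Finset (Fin m)).card : ℝ) := by
            gcongr with i _
            exact expect_abs_sgn_sum_le _
        _ ≤ 2 * α * √(d * m) := by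
            gcongr
            exact sum_sqrt_card_le a t
    · rw [Fintype.expect_const]
      have h1 : √(d * m : ℝ) = d * √(m / d : ℝ) := by
        rw [show (d * m : ℝ) = d ^ 2 * (m / d) by field_simp, Real.sqrt_mul (by positivity),
          Real.sqrt_sq (by positivity)]
      have h2 : √(m / d : ℝ) ≤ √(Real.log d + m / d) := Real.sqrt_le_sqrt (by linarith)
      rw [h1]
      calc 2 * α * (d * √(m / d : ℝ)) = 2 * (d * α * √(m / d : ℝ)) := by ring
        _ ≤ 300000 * (d * α * √(Real.log d + m / d)) := by gcongr; norm_num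
        _ = _ := by ring
  · obtain ⟨q, hq, hEq⟩ := exists_pairEdge_bound hd hm hab
    refine ⟨fun t => 3 * d * α * q t, fun t X hX => ?_, ?_⟩
    · have h1 := hq t (6 * d * α) X (fun ε => (hX ε).1) fun ε => (hX ε).2.1
      simp_rw [fun ε => trace_signedAdj_mul hab t ε (hX ε).1.1, abs_mul] at h1
      rw [← Finset.mul_expect, abs_two] at h1
      linarith
    · rw [← Finset.mul_expect]
      have h3 : 0 ≤ 3 * d * α := by positivity
      have := mul_le_mul_of_nonneg_left hEq h3
      linarith

end forms

/-! ### Deviations of the loss -/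

section losses
variable {d m : ℕ} {κ₀ α : ℝ} {K : Matrix (Fin 3) (Fin 3) ℝ} {Xs : Matrix (Idx d) (Idx d) ℝ}

lemma abs_frobInner_sensing_le (hK : ∀ a b, |K a b| ≤ κ₀) (hXs : Xs ∈ G d α)
    {X : Matrix (Idx d) (Idx d) ℝ} (hX : X ∈ G d α) (t : Triple d) :
    |frobInner (sensing K t) (X - Xs)| ≤ 36 * κ₀ * α := by
  have hκ : 0 ≤ κ₀ := (abs_nonneg _).trans (hK 0 0)
  rw [frobInner_sensing]
  calc |∑ a, ∑ b, K a b * (X - Xs) (a, t a) (b, t b)|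
      ≤ ∑ a : Fin 3, ∑ b : Fin 3, κ₀ * (2 * α + 2 * α) := by
        refine (Finset.abs_sum_le_sum_abs _ _).trans (Finset.sum_le_sum fun a _ => ?_)
        refine (Finset.abs_sum_le_sum_abs _ _).trans (Finset.sum_le_sum fun b _ => ?_)
        rw [abs_mul, Matrix.sub_apply]
        gcongr
        · exact hK a b
        · exact (abs_sub _ _).trans (add_le_add (abs_le_of_mem_G hX _ _) (abs_le_of_mem_G hXs _ _))
    _ = 36 * κ₀ * α := by simp; ring

/-- Bound for the Rademacher averages of the linear forms `⟨A_t, X - X⋆⟩` over `𝒢`. -/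
lemma exists_linear_bound (hd : 1 ≤ d) (hm : 1 ≤ m) (hα : 0 ≤ α) (hK : ∀ a b, |K a b| ≤ κ₀)
    (hXs : Xs ∈ G d α) :
    ∃ q : (Fin m → Triple d) → ℝ,
      (∀ (t : Fin m → Triple d) (X : (Fin m → Bool) → G d α),
        𝔼 ε, ∑ l, sgn (ε l) * frobInner (sensing K (t l)) ((X ε : Matrix _ _ ℝ) - Xs) ≤ q t) ∧
      𝔼 t, q t ≤ 5400000 * κ₀ * d * α * √(Real.log d + m / d) := by
  have hκ : 0 ≤ κ₀ := (abs_nonneg _).trans (hK 0 0)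
  choose q hq hEq using fun a b => exists_block_bound (d := d) (m := m) hd hm hα a b
  refine ⟨fun t => ∑ a, ∑ b, κ₀ * (q a b t + q a b t), fun t X => ?_, ?_⟩
  · have hpt : ∀ ε, ∑ l, sgn (ε l) * frobInner (sensing K (t l)) ((X ε : Matrix _ _ ℝ) - Xs) ≤
        ∑ a, ∑ b, κ₀ * (|∑ l, sgn (ε l) * (X ε : Matrix _ _ ℝ) (a, t l a) (b, t l b)| +
          |∑ l, sgn (ε l) * Xs (a, t l a) (b, t l b)|) := by
      intro ε
      have h1 : ∑ l, sgn (ε l) * frobInner (sensing K (t l)) ((X ε : Matrix _ _ ℝ) - Xs) =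
          ∑ a, ∑ b, K a b * (∑ l, sgn (ε l) * (X ε : Matrix _ _ ℝ) (a, t l a) (b, t l b) -
            ∑ l, sgn (ε l) * Xs (a, t l a) (b, t l b)) := by
        simp_rw [frobInner_sensing, Finset.mul_sum]
        rw [Finset.sum_comm]
        refine Finset.sum_congr rfl fun a _ => ?_
        rw [Finset.sum_comm]
        refine Finset.sum_congr rfl fun b _ => ?_
        rw [← Finset.sum_sub_distrib, Finset.mul_sum]
        exact Finset.sum_congr rfl fun l _ => by rw [Matrix.sub_apply]; ring
      rw [h1]
      refine Finset.sum_le_sum fun a _ => Finset.sum_le_sum fun b _ => (le_abs_self _).trans ?_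
      rw [abs_mul]
      exact mul_le_mul (hK a b) (abs_sub _ _) (abs_nonneg _) hκ
    refine (Finset.expect_le_expect fun ε _ => hpt ε).trans ?_
    rw [Finset.expect_sum_comm]
    refine Finset.sum_le_sum fun a _ => ?_
    rw [Finset.expect_sum_comm]
    refine Finset.sum_le_sum fun b _ => ?_
    rw [← Finset.mul_expect, Finset.expect_add_distrib]
    have h1 := hq a b t (fun ε => X ε) fun ε => (X ε).2
    have h2 := hq a b t (fun _ => Xs) fun _ => hXs
    gcongr
  · rw [Finset.expect_sum_comm]
    simp_rw [Finset.expect_sum_comm, ← Finset.mul_expect, Finset.expect_add_distrib]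
    calc ∑ a, ∑ b, κ₀ * (𝔼 t, q a b t + 𝔼 t, q a b t)
        ≤ ∑ _a : Fin 3, ∑ _b : Fin 3, κ₀ * (300000 * d * α * √(Real.log d + m / d) +
          300000 * d * α * √(Real.log d + m / d)) := by
          gcongr with a _ b _ <;> exact hEq a b
      _ = 5400000 * κ₀ * d * α * √(Real.log d + m / d) := by simp; ring

/-- Average deviation of the sums of squared errors over independent samples, in either
direction: `σ` is `1` or `-1`. -/
lemma expect_sum_sqError_le (hd : 1 ≤ d) (hm : 1 ≤ m) (hα : 0 ≤ α) (hK : ∀ a b, |K a b| ≤ κ₀)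
    (hXs : Xs ∈ G d α) {σ : ℝ} (hσ : |σ| = 1) (X : (Fin m → Triple d) → G d α) :
    𝔼 t, ∑ l, (σ * sqError K Xs (X t) (t l) - 𝔼 s, σ * sqError K Xs (X t) s) ≤
      777600000 * κ₀ ^ 2 * d * α ^ 2 * √(Real.log d + m / d) := by
  have : NeZero d := ⟨by omega⟩
  have hκ : 0 ≤ κ₀ := (abs_nonneg _).trans (hK 0 0)
  obtain ⟨q, hq, hEq⟩ := exists_linear_bound hd hm hα hK hXs
  have hlip : 0 ≤ 72 * κ₀ * α := by positivity
  refine (symmetrization (fun (X : G d α) s => σ * sqError K Xs X s)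
    (fun t => 72 * κ₀ * α * q t) (fun t Y => ?_) X).trans ?_
  · refine contraction (fun (X : G d α) l => σ * sqError K Xs X (t l))
      (fun (X : G d α) l =>
        72 * κ₀ * α * frobInner (sensing K (t l)) ((X : Matrix _ _ ℝ) - Xs)) ?_ ?_ Y
    · -- the square is `2 * B`-Lipschitz on `[-B, B]`, and `B = 36 * κ₀ * α` bounds the forms
      intro X Y l
      have h1 := abs_frobInner_sensing_le hK hXs X.2 (t l)
      have h2 := abs_frobInner_sensing_le hK hXs Y.2 (t l)
      rw [← mul_sub, abs_mul, hσ, one_mul, ← mul_sub, abs_mul, abs_of_nonneg hlip, sqError,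
        sqError, sq_sub_sq, abs_mul]
      refine mul_le_mul_of_nonneg_right ((abs_add_le _ _).trans ?_) (abs_nonneg _)
      linarith
    · intro Y
      have h1 := mul_le_mul_of_nonneg_left (hq t Y) hlip
      rw [Finset.mul_expect] at h1
      refine le_trans (le_of_eq (Finset.expect_congr rfl fun ε _ => ?_)) h1
      rw [Finset.mul_sum]
      exact Finset.sum_congr rfl fun l _ => by ring
  · rw [← Finset.mul_expect]
    have h1 := mul_le_mul_of_nonneg_left hEq hlip
    linarith

lemma loss_univ_eq (X : Matrix (Idx d) (Idx d) ℝ) :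
    loss K Xs univ X = 𝔼 s, sqError K Xs X s := by
  rw [Fintype.expect_eq_sum_div_card, loss, Finset.card_univ, one_div, inv_mul_eq_div]

lemma sqError_nonneg (X : Matrix (Idx d) (Idx d) ℝ) (s : Triple d) : 0 ≤ sqError K Xs X s :=
  sq_nonneg _

lemma sqError_self (s : Triple d) : sqError K Xs Xs s = 0 := by
  simp [sqError, frobInner]

lemma sqError_le (hK : ∀ a b, |K a b| ≤ κ₀) (hXs : Xs ∈ G d α)
    {X : Matrix (Idx d) (Idx d) ℝ} (hX : X ∈ G d α) (t : Triple d) :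
    sqError K Xs X t ≤ (36 * κ₀ * α) ^ 2 :=
  sq_le_sq' (abs_le.1 (abs_frobInner_sensing_le hK hXs hX t)).1
    (abs_le.1 (abs_frobInner_sensing_le hK hXs hX t)).2

/-- For empty `s` the average is `0`, which is why `0 ≤ B` is required. -/
lemma average_mem_Icc {ι : Type*} (s : Finset ι) {f : ι → ℝ} {B : ℝ} (hB : 0 ≤ B)
    (h0 : ∀ i, 0 ≤ f i) (h1 : ∀ i, f i ≤ B) :
    0 ≤ (1 / (s.card : ℝ)) * ∑ i ∈ s, f i ∧ (1 / (s.card : ℝ)) * ∑ i ∈ s, f i ≤ B := by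
  refine ⟨mul_nonneg (by positivity) (Finset.sum_nonneg fun i _ => h0 i), ?_⟩
  rcases s.eq_empty_or_nonempty with rfl | hs
  · simpa using hB
  · have hc : (0 : ℝ) < s.card := by exact_mod_cast hs.card_pos
    have := Finset.sum_le_card_nsmul s f B fun i _ => h1 i
    rw [nsmul_eq_mul] at this
    rw [one_div, inv_mul_le_iff₀ hc]
    exact this

lemma bddAbove_deviations (hK : ∀ a b, |K a b| ≤ κ₀) (hXs : Xs ∈ G d α)
    {ℓ : Matrix (Idx d) (Idx d) ℝ → ℝ}
    (hℓ : ∀ X ∈ G d α, 0 ≤ ℓ X ∧ ℓ X ≤ (36 * κ₀ * α) ^ 2) :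
    BddAbove (deviations K Xs α ℓ) := by
  refine ⟨(36 * κ₀ * α) ^ 2, ?_⟩
  rintro _ ⟨X, hX, rfl⟩
  obtain ⟨h1, h2⟩ := hℓ X hX
  obtain ⟨h3, h4⟩ := average_mem_Icc (univ : Finset (Triple d)) (sq_nonneg _)
    (sqError_nonneg X) (sqError_le hK hXs hX)
  change |ℓ X - (1 / ((univ : Finset (Triple d)).card : ℝ)) * _| ≤ _
  rw [abs_le]
  constructor <;> linarith

lemma bddAbove_deviations_loss (hK : ∀ a b, |K a b| ≤ κ₀) (hXs : Xs ∈ G d α)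
    (S : Finset (Triple d)) : BddAbove (deviations K Xs α (loss K Xs S)) :=
  bddAbove_deviations hK hXs fun X hX =>
    average_mem_Icc S (sq_nonneg _) (sqError_nonneg X) (sqError_le hK hXs hX)

lemma bddAbove_deviations_sampleLoss (hK : ∀ a b, |K a b| ≤ κ₀) (hXs : Xs ∈ G d α)
    (t : Fin m → Triple d) : BddAbove (deviations K Xs α (sampleLoss K Xs t)) :=
  bddAbove_deviations hK hXs fun X hX => by
    have := average_mem_Icc (univ : Finset (Fin m)) (f := fun l => sqError K Xs X (t l))
      (sq_nonneg _) (fun l => sqError_nonneg X (t l)) (fun l => sqError_le hK hXs hX (t l))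
    rwa [Finset.card_univ, Fintype.card_fin] at this

/-- Passage from choices to suprema. The deviation vanishes at `X⋆`, so the supremum of its
absolute value is at most the sum of the suprema of the two one-sided deviations. -/
lemma expect_sSup_deviations_le {ι : Type*} {S : Finset ι} (hS : S.Nonempty) (hXs : Xs ∈ G d α)
    (ℓ : ι → Matrix (Idx d) (Idx d) ℝ → ℝ)
    (hzero : ∀ i, ℓ i Xs = loss K Xs univ Xs) {Q : ℝ}
    (hQ : ∀ X : ι → G d α, 𝔼 i ∈ S, (ℓ i (X i) - loss K Xs univ (X i)) ≤ Q)
    (hQ' : ∀ X : ι → G d α, 𝔼 i ∈ S, (loss K Xs univ (X i) - ℓ i (X i)) ≤ Q) :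
    𝔼 i ∈ S, sSup (deviations K Xs α (ℓ i)) ≤ 2 * Q := by
  refine le_of_forall_pos_le_add fun η hη => ?_
  have hchoice : ∀ i, ∃ X : G d α, i ∈ S →
      sSup (deviations K Xs α (ℓ i)) ≤ |ℓ i X - loss K Xs univ X| + η := by
    intro i
    have hne : (deviations K Xs α (ℓ i)).Nonempty := ⟨_, Xs, hXs, rfl⟩
    by_cases hi : i ∈ S
    · obtain ⟨_, ⟨X, hX, rfl⟩, h⟩ :=
        exists_lt_of_lt_csSup hne (sub_lt_self (sSup (deviations K Xs α (ℓ i))) hη)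
      exact ⟨⟨X, hX⟩, fun _ => by simp only at h ⊢; linarith⟩
    · exact ⟨⟨Xs, hXs⟩, fun h => absurd h hi⟩
  choose X hX using hchoice
  let Z : G d α := ⟨Xs, hXs⟩
  have hZ : ∀ i, ℓ i Z - loss K Xs univ Z = 0 := fun i => sub_eq_zero.2 (hzero i)
  let P : ι → G d α := fun i => if 0 ≤ ℓ i (X i) - loss K Xs univ (X i) then X i else Z
  let N : ι → G d α := fun i => if 0 ≤ ℓ i (X i) - loss K Xs univ (X i) then Z else X i
  have hpt : ∀ i ∈ S, sSup (deviations K Xs α (ℓ i)) ≤ (ℓ i (P i) - loss K Xs univ (P i)) +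
      (loss K Xs univ (N i) - ℓ i (N i)) + η := by
    intro i hi
    refine (hX i hi).trans ?_
    have h0 := hZ i
    by_cases h : 0 ≤ ℓ i (X i) - loss K Xs univ (X i)
    · simp only [P, N, if_pos h]
      rw [abs_of_nonneg h]
      linarith
    · simp only [P, N, if_neg h]
      rw [abs_of_neg (not_le.1 h)]
      linarith
  calc 𝔼 i ∈ S, sSup (deviations K Xs α (ℓ i))
      ≤ 𝔼 i ∈ S, ((ℓ i (P i) - loss K Xs univ (P i)) +
          (loss K Xs univ (N i) - ℓ i (N i)) + η) := Finset.expect_le_expect hpt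
    _ = 𝔼 i ∈ S, (ℓ i (P i) - loss K Xs univ (P i)) +
          𝔼 i ∈ S, (loss K Xs univ (N i) - ℓ i (N i)) + η := by
        rw [Finset.expect_add_distrib, Finset.expect_add_distrib, Finset.expect_const hS]
    _ ≤ 2 * Q + η := by
        have h1 := hQ P
        have h2 := hQ' N
        linarith

/-- Mean one-sided deviation of the loss over independent samples. -/
lemma expect_sampleLoss_sub_le (hd : 1 ≤ d) (hm : 1 ≤ m) (hα : 0 ≤ α)
    (hK : ∀ a b, |K a b| ≤ κ₀) (hXs : Xs ∈ G d α) {σ : ℝ} (hσ : |σ| = 1)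
    (X : (Fin m → Triple d) → G d α) :
    𝔼 t, σ * (sampleLoss K Xs t (X t) - loss K Xs univ (X t)) ≤
      1 / m * (777600000 * κ₀ ^ 2 * d * α ^ 2 * √(Real.log d + m / d)) := by
  have hm0 : (m : ℝ) ≠ 0 := by positivity
  have h := mul_le_mul_of_nonneg_left (expect_sum_sqError_le hd hm hα hK hXs hσ X)
    (show (0 : ℝ) ≤ 1 / m by positivity)
  rw [Finset.mul_expect] at h
  refine le_trans (le_of_eq (Finset.expect_congr rfl fun t _ => ?_)) h
  rw [← Finset.mul_expect, ← loss_univ_eq, Finset.sum_sub_distrib, ← Finset.mul_sum,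
    Finset.sum_const, Finset.card_univ, Fintype.card_fin, nsmul_eq_mul, sampleLoss]
  field_simp

/-- Mean one-sided deviation of the loss over a uniformly random set of `m` triples. -/
lemma expect_loss_sub_le (hd : 1 ≤ d) (hm : 1 ≤ m) (hmd : m ≤ d ^ 3) (hα : 0 ≤ α)
    (hK : ∀ a b, |K a b| ≤ κ₀) (hXs : Xs ∈ G d α) {σ : ℝ} (hσ : |σ| = 1)
    (X : Finset (Triple d) → G d α) :
    𝔼 Ω ∈ powersetCard m univ, σ * (loss K Xs Ω (X Ω) - loss K Xs univ (X Ω)) ≤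
      1 / m * (777600000 * κ₀ ^ 2 * d * α ^ 2 * √(Real.log d + m / d)) := by
  have hm0 : (m : ℝ) ≠ 0 := by positivity
  have h := mul_le_mul_of_nonneg_left (expect_powersetCard_le hm (by simpa using hmd)
    (fun (X : G d α) s => σ * sqError K Xs X s - 𝔼 s, σ * sqError K Xs X s)
    (expect_sum_sqError_le hd hm hα hK hXs hσ) X)
    (show (0 : ℝ) ≤ 1 / m by positivity)
  rw [Finset.mul_expect] at h
  refine le_trans (le_of_eq (Finset.expect_congr rfl fun Ω hΩ => ?_)) h
  rw [← Finset.mul_expect, ← loss_univ_eq, Finset.sum_sub_distrib, ← Finset.mul_sum,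
    Finset.sum_const, (Finset.mem_powersetCard.1 hΩ).2, nsmul_eq_mul, loss,
    (Finset.mem_powersetCard.1 hΩ).2]
  field_simp

lemma two_mul_rate_le (hd : 1 ≤ d) (hm : 1 ≤ m) :
    2 * (1 / m * (777600000 * κ₀ ^ 2 * d * α ^ 2 * √(Real.log d + m / d))) ≤
      (1555200000 * κ₀ ^ 2 + 1) * α ^ 2 *
        √((d : ℝ) / m + (d : ℝ) ^ 2 * Real.log d / (m : ℝ) ^ 2) := by
  have hd0 : (0 : ℝ) < d := by exact_mod_cast hd
  have hm0 : (0 : ℝ) < m := by exact_mod_cast hm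
  have h1 : √((d : ℝ) / m + (d : ℝ) ^ 2 * Real.log d / (m : ℝ) ^ 2) =
      d / m * √(Real.log d + m / d) := by
    rw [show (d : ℝ) / m + (d : ℝ) ^ 2 * Real.log d / (m : ℝ) ^ 2 =
      (d / m : ℝ) ^ 2 * (Real.log d + m / d) by field_simp; ring, Real.sqrt_mul (by positivity),
      Real.sqrt_sq (by positivity)]
  rw [h1]
  have h2 : 0 ≤ α ^ 2 * (d / m * √(Real.log d + m / d)) := by positivity
  calc _ = 1555200000 * κ₀ ^ 2 * (α ^ 2 * (d / m * √(Real.log d + m / d))) := by ring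
    _ ≤ (1555200000 * κ₀ ^ 2 + 1) * (α ^ 2 * (d / m * √(Real.log d + m / d))) := by
      gcongr; linarith
    _ = _ := by ring

end losses
end QuadTensor

theorem lemma3 (κ₀ : ℝ) :
    ∃ c : ℝ, 0 < c ∧
      ∀ (K : Matrix (Fin 3) (Fin 3) ℝ), K.IsSymm → (∀ a b, |K a b| ≤ κ₀) →
      ∀ (d r m : ℕ) (α : ℝ) (A B C : Matrix (Fin d) (Fin r) ℝ),
        1 ≤ d → 1 ≤ m → 0 ≤ α →
        (∀ i, ‖WithLp.toLp 2 (A i)‖ ≤ √α) →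
        (∀ i, ‖WithLp.toLp 2 (B i)‖ ≤ √α) →
        (∀ i, ‖WithLp.toLp 2 (C i)‖ ≤ √α) →
        -- a uniformly random subset of `m` triples
        (m ≤ d ^ 3 →
          (∀ Ω ∈ Finset.powersetCard m (Finset.univ : Finset (QuadTensor.Triple d)),
            BddAbove (QuadTensor.deviations K (QuadTensor.trueMatrix A B C) α
              (QuadTensor.loss K (QuadTensor.trueMatrix A B C) Ω))) ∧
          Finset.expect (Finset.powersetCard m (Finset.univ : Finset (QuadTensor.Triple d)))
            (fun Ω => sSup (QuadTensor.deviations K (QuadTensor.trueMatrix A B C) α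
              (QuadTensor.loss K (QuadTensor.trueMatrix A B C) Ω)))
            ≤ c * α ^ 2 * √((d : ℝ) / m + (d : ℝ) ^ 2 * Real.log d / (m : ℝ) ^ 2)) ∧
        -- `m` independent uniformly random triples
        ((∀ t : Fin m → QuadTensor.Triple d,
            BddAbove (QuadTensor.deviations K (QuadTensor.trueMatrix A B C) α
              (QuadTensor.sampleLoss K (QuadTensor.trueMatrix A B C) t))) ∧
          Finset.expect (Finset.univ : Finset (Fin m → QuadTensor.Triple d))
            (fun t => sSup (QuadTensor.deviations K (QuadTensor.trueMatrix A B C) α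
              (QuadTensor.sampleLoss K (QuadTensor.trueMatrix A B C) t)))
            ≤ c * α ^ 2 * √((d : ℝ) / m + (d : ℝ) ^ 2 * Real.log d / (m : ℝ) ^ 2)) := by
  refine ⟨1555200000 * κ₀ ^ 2 + 1, by positivity, ?_⟩
  intro K _ hK d r m α A B C hd hm hα hA hB hC
  have hXs := QuadTensor.trueMatrix_mem_G hα hA hB hC
  refine ⟨fun hmd => ⟨fun Ω _ => QuadTensor.bddAbove_deviations_loss hK hXs Ω, ?_⟩,
    fun t => QuadTensor.bddAbove_deviations_sampleLoss hK hXs t, ?_⟩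
  · refine le_trans (QuadTensor.expect_sSup_deviations_le ?_ hXs _ ?_ ?_ ?_)
      (QuadTensor.two_mul_rate_le hd hm)
    · exact Finset.powersetCard_nonempty.2 (by simpa using hmd)
    · intro Ω
      simp [QuadTensor.loss, QuadTensor.sqError_self]
    · intro X
      simpa using QuadTensor.expect_loss_sub_le hd hm hmd hα hK hXs abs_one X
    · intro X
      simpa using QuadTensor.expect_loss_sub_le hd hm hmd hα hK hXs (σ := -1) (by simp) X
  · refine le_trans (QuadTensor.expect_sSup_deviations_le ?_ hXs _ ?_ ?_ ?_)
      (QuadTensor.two_mul_rate_le hd hm)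
    · have : NeZero d := ⟨by omega⟩
      exact Finset.univ_nonempty
    · intro t
      simp [QuadTensor.loss, QuadTensor.sampleLoss, QuadTensor.sqError_self]
    · intro X
      simpa using QuadTensor.expect_sampleLoss_sub_le hd hm hα hK hXs abs_one X
    · intro X
      simpa using QuadTensor.expect_sampleLoss_sub_le hd hm hα hK hXs (σ := -1) (by simp) X
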